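/- Let $\mathbb{K}$ be an algebraically closed field of characteristic zero, and let $X$ be an irreducible quasiaffine variety over $\mathbb{K}$ (an irreducible locally closed subset of some affine space $\mathbb{K}^n$) which is rigid, that is, $X$ admits no nontrivial regular action $\mathbb{G}_a\times X\to X$ of the additive group $\mathbb{G}_a=(\mathbb{K},+)$. A torus is an algebraic group $T\cong(\mathbb{K}^\times)^m$ with $m\ge 0$, and a subtorus of the group $\mathrm{Aut}(X)$ of all automorphisms of $X$ is the image in $\mathrm{Aut}(X)$ of a torus under an effective regular action on $X$. Then there is a subtorus $\mathbb{T}\subseteq\mathrm{Aut}(X)$ such that for every regular torus action $T\times X\to X$ the image of $T$ in $\mathrm{Aut}(X)$ is contained in $\mathbb{T}$. In particular, $\mathbb{T}$ is the unique maximal torus in $\mathrm{Aut}(X)$: it is the only maximal element, with respect to inclusion, among the subtori of $\mathrm{Aut}(X)$. -/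

import Mathlib

namespace QuasiAffine

/-- The Zariski topology on the affine space `K^n`: the closed sets are the sets of common zeros of
sets of polynomials. -/
abbrev zariski (K : Type*) [Field K] (n : ℕ) : TopologicalSpace (Fin n → K) :=
  TopologicalSpace.ofClosed
    {Z | ∃ S : Set (MvPolynomial (Fin n) K), Z = {x | ∀ p ∈ S, MvPolynomial.eval x p = 0}}
    ⟨{1}, by ext x; simp⟩
    (by
      intro A hA
      refine ⟨{p | ∃ Z ∈ A, ∀ x ∈ Z, MvPolynomial.eval x p = 0}, ?_⟩
      ext x
      simp only [Set.mem_sInter, Set.mem_ofPred_eq]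
      constructor
      · rintro hx p ⟨Z, hZ, hp⟩
        exact hp x (hx Z hZ)
      · intro hx Z hZ
        obtain ⟨S, rfl⟩ := hA hZ
        exact fun p hp => hx p ⟨_, hZ, fun y hy => hy p hp⟩)
    (by
      rintro _ ⟨S, rfl⟩ _ ⟨S', rfl⟩
      refine ⟨{r | ∃ p ∈ S, ∃ q ∈ S', r = p * q}, ?_⟩
      ext x
      simp only [Set.mem_union, Set.mem_ofPred_eq]
      constructor
      · rintro (h | h) _ ⟨p, hp, q, hq, rfl⟩
        · simp [h p hp]
        · simp [h q hq]
      · intro h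
        by_contra! hne
        obtain ⟨⟨p, hp, hp0⟩, q, hq, hq0⟩ := hne
        have := h _ ⟨p, hp, q, hq, rfl⟩
        simp [hp0, hq0] at this)

/-- An irreducible quasiaffine variety embedded in `K^n`: an irreducible (in particular nonempty)
locally closed subset of `K^n`, that is, an irreducible set which is open in a Zariski closed
set. -/
structure IsIrredQuasiAffine {K : Type*} [Field K] {n : ℕ} (X : Set (Fin n → K)) : Prop where
  locallyClosed : @IsLocallyClosed _ (zariski K n) X
  irreducible : @IsIrreducible _ (zariski K n) X

section Regular

variable {K : Type*} [Field K] {ι κ τ : Type*} {P Q R : Type*}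

/-- Let `P` be a set realized in the affine space `K^ι` by the coordinates `e : P → K^ι`.
A function on `P` is regular if near each point it is a quotient of two polynomials in the
coordinates. (The sets `{q ≠ 0}` form a basis of the Zariski topology, and both polynomials may be
multiplied by a common factor, so it suffices to use neighbourhoods of the form `{q ≠ 0}`, where
`q` is the denominator.) -/
def IsRegularFun (e : P → ι → K) (f : P → K) : Prop :=
  ∀ x : P, ∃ p q : MvPolynomial ι K, MvPolynomial.eval (e x) q ≠ 0 ∧
    ∀ y : P, MvPolynomial.eval (e y) q ≠ 0 →
      f y = MvPolynomial.eval (e y) p / MvPolynomial.eval (e y) q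

/-- A map is regular (a morphism) if its coordinate functions are regular. -/
def IsRegularMap (e : P → ι → K) (e' : Q → κ → K) (φ : P → Q) : Prop :=
  ∀ j : κ, IsRegularFun e fun x => e' (φ x) j

/-- The coordinates on a product: `K^ι × K^κ = K^(ι ⊕ κ)`. -/
def prodCoord (e : P → ι → K) (e' : Q → κ → K) : P × Q → ι ⊕ κ → K :=
  fun z => Sum.elim (e z.1) (e' z.2)

theorem IsRegularFun.of_polynomial (e : P → ι → K) (p : MvPolynomial ι K) :
    IsRegularFun e fun x => MvPolynomial.eval (e x) p :=
  fun _ => ⟨p, 1, by simp, fun _ _ => by simp⟩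

theorem IsRegularFun.add {e : P → ι → K} {f g : P → K} (hf : IsRegularFun e f)
    (hg : IsRegularFun e g) : IsRegularFun e fun x => f x + g x := by
  intro x
  obtain ⟨p, q, hq, h⟩ := hf x
  obtain ⟨p', q', hq', h'⟩ := hg x
  refine ⟨p * q' + q * p', q * q', by simp [hq, hq'], fun y hy => ?_⟩
  rw [map_mul] at hy
  have h1 := left_ne_zero_of_mul hy
  have h2 := right_ne_zero_of_mul hy
  simp only [h y h1, h' y h2, map_mul, map_add]
  rw [div_add_div _ _ h1 h2]

theorem IsRegularFun.mul {e : P → ι → K} {f g : P → K} (hf : IsRegularFun e f)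
    (hg : IsRegularFun e g) : IsRegularFun e fun x => f x * g x := by
  intro x
  obtain ⟨p, q, hq, h⟩ := hf x
  obtain ⟨p', q', hq', h'⟩ := hg x
  refine ⟨p * p', q * q', by simp [hq, hq'], fun y hy => ?_⟩
  rw [map_mul] at hy
  have h1 := left_ne_zero_of_mul hy
  have h2 := right_ne_zero_of_mul hy
  simp only [h y h1, h' y h2, map_mul]
  rw [div_mul_div_comm]

theorem IsRegularFun.eval_comp {e : P → ι → K} {e' : Q → κ → K} {φ : P → Q}
    (hφ : IsRegularMap e e' φ) (p : MvPolynomial κ K) :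
    IsRegularFun e fun x => MvPolynomial.eval (e' (φ x)) p := by
  induction p using MvPolynomial.induction_on with
  | C a => simpa using IsRegularFun.of_polynomial e (MvPolynomial.C a)
  | add p q hp hq => simpa using hp.add hq
  | mul_X p i hp => simpa using hp.mul (hφ i)

theorem IsRegularFun.comp {e : P → ι → K} {e' : Q → κ → K} {f : Q → K} {φ : P → Q}
    (hf : IsRegularFun e' f) (hφ : IsRegularMap e e' φ) :
    IsRegularFun e fun x => f (φ x) := by
  intro x
  obtain ⟨p, q, hq, h⟩ := hf (φ x)
  obtain ⟨a, b, hb, hab⟩ := IsRegularFun.eval_comp hφ p x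
  obtain ⟨c, d, hd, hcd⟩ := IsRegularFun.eval_comp hφ q x
  have hc : MvPolynomial.eval (e x) c ≠ 0 := by
    intro h0
    apply hq
    have := hcd x hd
    simpa [h0] using this
  refine ⟨a * d * d, b * c * d, by simp [hb, hc, hd], fun y hy => ?_⟩
  simp only [map_mul] at hy
  have hyd := right_ne_zero_of_mul hy
  have hyc := right_ne_zero_of_mul (left_ne_zero_of_mul hy)
  have hyb := left_ne_zero_of_mul (left_ne_zero_of_mul hy)
  have e1 : MvPolynomial.eval (e' (φ y)) p = _ := hab y hyb
  have e2 : MvPolynomial.eval (e' (φ y)) q = _ := hcd y hyd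
  have hq' : MvPolynomial.eval (e' (φ y)) q ≠ 0 := by
    rw [e2]
    exact div_ne_zero hyc hyd
  simp only [h (φ y) hq', e1, e2, map_mul]
  field_simp

theorem IsRegularMap.comp {e : P → ι → K} {e' : Q → κ → K} {e'' : R → τ → K} {ψ : Q → R}
    {φ : P → Q} (hψ : IsRegularMap e' e'' ψ) (hφ : IsRegularMap e e' φ) :
    IsRegularMap e e'' fun x => ψ (φ x) :=
  fun j => (hψ j).comp hφ

theorem IsRegularMap.id (e : P → ι → K) : IsRegularMap e e fun x => x :=
  fun j => by simpa using IsRegularFun.of_polynomial e (MvPolynomial.X j)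

end Regular

section Actions

variable {K : Type*} [Field K] {n : ℕ}

/-- The group `Aut(X)` of all automorphisms of the variety `X`: the bijections `X → X` which are
regular together with their inverses. -/
def Aut (X : Set (Fin n → K)) : Subgroup (Equiv.Perm X) where
  carrier := {φ | IsRegularMap (Subtype.val : X → Fin n → K) (Subtype.val : X → Fin n → K) φ ∧
    IsRegularMap (Subtype.val : X → Fin n → K) (Subtype.val : X → Fin n → K) φ.symm}
  one_mem' := ⟨IsRegularMap.id _, IsRegularMap.id _⟩
  mul_mem' := fun ha hb => ⟨ha.1.comp hb.1, hb.2.comp ha.2⟩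
  inv_mem' := fun ha => ⟨ha.2, ha.1⟩

/-- Let `G` be an algebraic group realized in the affine space `K^κ` by the coordinates `c`.
An action of `G` on `X` by automorphisms, given by the homomorphism `ρ : G → Aut(X)`, is regular
(algebraic) if the action map `G × X → X` is a morphism. -/
def IsRegularAction {G κ : Type*} [Group G] (c : G → κ → K) {X : Set (Fin n → K)}
    (ρ : G →* Aut X) : Prop :=
  IsRegularMap (prodCoord c (Subtype.val : X → Fin n → K)) (Subtype.val : X → Fin n → K)
    fun z : G × X => (ρ z.1 : Equiv.Perm X) z.2

/-- The additive group `𝔾ₐ = (K, +)`, written multiplicatively, as the affine line. -/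
def gaCoord (K : Type*) : Multiplicative K → Unit → K :=
  fun s _ => s.toAdd

/-- The torus `(Kˣ)^m`, as the open subset of `K^m` where no coordinate vanishes. -/
def torusCoord (K : Type*) [Field K] (m : ℕ) : (Fin m → Kˣ) → Fin m → K :=
  fun t i => (t i : K)

/-- A variety is rigid if it admits no nontrivial `𝔾ₐ`-action. -/
def IsRigid (X : Set (Fin n → K)) : Prop :=
  ∀ ρ : Multiplicative K →* Aut X, IsRegularAction (gaCoord K) ρ → ρ = 1

/-- A subtorus of `Aut(X)`: a subgroup which is the isomorphic image of a torus acting regularly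
and effectively on `X`. -/
def IsSubtorus {X : Set (Fin n → K)} (H : Subgroup (Aut X)) : Prop :=
  ∃ (m : ℕ) (ρ : (Fin m → Kˣ) →* Aut X),
    IsRegularAction (torusCoord K m) ρ ∧ Function.Injective ρ ∧ ρ.range = H

end Actions

end QuasiAffine

namespace QuasiAffine

/-! ### Locally nilpotent derivations: degrees, kernels, exponentials. -/

section LocallyNilpotent

variable {K A : Type*} [Field K] [CommRing A] [Algebra K A]

/-! Let `A` be the algebra of regular functions on `X`. A one-dimensional torus acting on `X` grades
`A`, and the grading has an Euler derivation, which multiplies functions of weight `i` by `i`.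

Rigidity enters only through the absence of nonzero locally nilpotent derivations `D` of `A`
(`IsRigid.eq_zero_of_isLocallyNilpotent`). As `X` is merely quasiaffine, the exponential of `s • D`
may move points out of `X`. But the ideal generated by functions cutting out the boundary contains a
nonzero `h` with `D h = 0`; the flow of `h • D` preserves `h` and fixes its zeros, so it stays in
`X`.

Given two gradings, split the Euler derivation of one into homogeneous components for the other. An
extreme component of nonzero degree would be locally nilpotent: its iterates move degrees off to
infinity, while iterates of the Euler derivation keep each element in a finite-dimensional space. So
there is none, and the two gradings are compatible (`proj_mem_of_mem`).

Compatible gradings have joint weight vectors spanning `A`, which makes `K`-independent Euler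
derivations independent over `A`; derivations embed in `A^n`, so finitely many cocharacters span all
the Euler derivations. The joint weight vectors of these finitely many are then weight vectors of
every cocharacter (`exists_weightVectors`). Choose a finite set `G` of them spanning the
coordinates. Automorphisms scaling `G` form a subgroup of a diagonal torus; the exponents of its
one-parameter subgroups form a lattice, whose saturation gives the largest torus
(`exists_largest_subtorus`). -/

theorem iterate_derivation_mul (D : Derivation K A A) (k : ℕ) (a b : A) :
    D^[k] (a * b) =
      ∑ ij ∈ Finset.HasAntidiagonal.antidiagonal k, k.choose ij.1 • (D^[ij.1] a * D^[ij.2] b) := by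
  induction k with
  | zero => simp
  | succ k ih =>
    rw [Finset.sum_antidiagonal_choose_succ_nsmul (M := A) (fun i j => D^[i] a * D^[j] b) k]
    simp only [Function.iterate_succ_apply', ih, map_sum, map_nsmul, Derivation.leibniz,
      smul_eq_mul, nsmul_add, Finset.sum_add_distrib]
    congr 1
    refine Finset.sum_congr rfl fun ij hij => ?_
    rw [k.choose_symm_of_eq_add (Finset.HasAntidiagonal.mem_antidiagonal.1 hij).symm, mul_comm]

theorem iterate_derivation_zero_of_le (D : Derivation K A A) {a : A} {k l : ℕ} (h : D^[k] a = 0)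
    (hkl : k ≤ l) : D^[l] a = 0 := by
  obtain ⟨j, rfl⟩ := Nat.exists_eq_add_of_le' hkl
  rw [Function.iterate_add_apply, h, Function.iterate_fixed (map_zero D)]

/-- Any Leibniz term other than `(a, b)` differentiates `f` more than `a` times or `g` more than `b`
times. In a domain of characteristic zero, degrees with respect to `D` therefore add. -/
theorem iterate_derivation_mul_top (D : Derivation K A A) {a b : ℕ} {f g : A}
    (hf : D^[a + 1] f = 0) (hg : D^[b + 1] g = 0) :
    D^[a + b] (f * g) = (a + b).choose a • (D^[a] f * D^[b] g) := by
  rw [iterate_derivation_mul, Finset.sum_eq_single (a, b)]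
  · rintro ⟨i, j⟩ hij hne
    rw [Finset.HasAntidiagonal.mem_antidiagonal] at hij
    simp only at hij
    rcases lt_trichotomy i a with h | h | h
    · simp [iterate_derivation_zero_of_le D hg (show b + 1 ≤ j by omega)]
    · exact absurd (by ext <;> simp <;> omega) hne
    · simp [iterate_derivation_zero_of_le D hf (show a + 1 ≤ i by omega)]
  · simp

theorem iterate_derivation_mul_eq_zero (D : Derivation K A A) {a b : ℕ} {f g : A}
    (hf : D^[a + 1] f = 0) (hg : D^[b + 1] g = 0) : D^[a + b + 1] (f * g) = 0 := by
  rw [iterate_derivation_mul]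
  refine Finset.sum_eq_zero ?_
  rintro ⟨i, j⟩ hij
  rw [Finset.HasAntidiagonal.mem_antidiagonal] at hij
  simp only at hij ⊢
  by_cases h : a + 1 ≤ i
  · simp [iterate_derivation_zero_of_le D hf h]
  · simp [iterate_derivation_zero_of_le D hg (show b + 1 ≤ j by omega)]

theorem iterate_derivation_mul_of_ker (D : Derivation K A A) {c : A} (hc : D c = 0) (k : ℕ)
    (f : A) : D^[k] (c * f) = c * D^[k] f := by
  induction k with
  | zero => simp
  | succ k ih => simp [Function.iterate_succ_apply', ih, hc]

/-- A derivation is locally nilpotent if each element is killed by some power of it. -/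
def IsLocallyNilpotent (D : Derivation K A A) : Prop :=
  ∀ a, ∃ N : ℕ, D^[N] a = 0

theorem IsLocallyNilpotent.exists_top {D : Derivation K A A} (hD : IsLocallyNilpotent D) {a : A}
    (ha : a ≠ 0) : ∃ N : ℕ, D^[N] a ≠ 0 ∧ D^[N + 1] a = 0 := by
  classical
  have h := hD a
  have h0 : Nat.find h ≠ 0 := fun h0 => ha (by simpa [h0] using Nat.find_spec h)
  obtain ⟨N, hN⟩ := Nat.exists_eq_succ_of_ne_zero h0
  exact ⟨N, Nat.find_min h (by omega), by rw [← Nat.succ_eq_add_one, ← hN]; exact Nat.find_spec h⟩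

section Domain

variable [IsDomain A] [CharZero A]

/-- An element `r` of degree exactly one has powers of every degree; they serve to match degrees in
the pseudo-division below. -/
theorem iterate_derivation_pow (D : Derivation K A A) {r : A} (hr : D r ≠ 0)
    (hr2 : D (D r) = 0) (b : ℕ) : D^[b] (r ^ b) ≠ 0 ∧ D^[b + 1] (r ^ b) = 0 := by
  induction b with
  | zero => simp
  | succ b ih =>
    rw [pow_succ, iterate_derivation_mul_top D (b := 1) ih.2 hr2,
      iterate_derivation_mul_eq_zero D (b := 1) ih.2 hr2]
    refine ⟨smul_ne_zero (Nat.choose_pos (by omega)).ne' (mul_ne_zero ih.1 hr), rfl⟩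

/-- Degrees of nonzero factors add, so a product of degree zero has factors of degree zero: the
kernel is factorially closed. -/
theorem IsLocallyNilpotent.ker_of_mul {D : Derivation K A A} (hD : IsLocallyNilpotent D) {d y : A}
    (hdy : d * y ≠ 0) (h : D (d * y) = 0) : D d = 0 := by
  obtain ⟨a, ha, ha'⟩ := hD.exists_top (left_ne_zero_of_mul hdy)
  obtain ⟨b, hb, hb'⟩ := hD.exists_top (right_ne_zero_of_mul hdy)
  have h1 : D^[a + b] (d * y) ≠ 0 := by
    rw [iterate_derivation_mul_top D ha' hb']
    exact smul_ne_zero (Nat.choose_pos (by omega)).ne' (mul_ne_zero ha hb)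
  have h2 : a + b = 0 := by
    by_contra h0
    exact h1 (iterate_derivation_zero_of_le D (k := 1) h (by omega))
  obtain rfl : a = 0 := by omega
  exact ha'

/-- Pseudo-division by an element of minimal positive degree in an ideal. -/
theorem exists_ker_mul_eq (D : Derivation K A A) {J : Ideal A} {d : A} {m : ℕ} (hd : d ∈ J)
    (hm : D^[m + 1] d ≠ 0) (hm' : D^[m + 2] d = 0) (hmin : ∀ g ∈ J, D^[m + 1] g = 0 → g = 0)
    (a : ℕ) : ∀ g ∈ J, D^[a] g = 0 → ∃ c, c ≠ 0 ∧ D c = 0 ∧ ∃ u, c * g = d * u := by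
  induction a with
  | zero => exact fun g _ hg => ⟨1, one_ne_zero, by simp, 0, by simp [show g = 0 from hg]⟩
  | succ a ih =>
    intro g hg hag
    by_cases hma : a < m + 1
    · exact ⟨1, one_ne_zero, by simp, 0, by
        simp [hmin g hg (iterate_derivation_zero_of_le D hag (by omega))]⟩
    obtain ⟨b, rfl⟩ := Nat.exists_eq_add_of_le (not_lt.1 hma)
    -- Since `d` has degree `m + 1`, `r` has degree one and `d * r ^ b` has degree `m + 1 + b`, the
    -- largest that `g` can have.
    set r := D^[m] d with hr
    have hr1 : D r ≠ 0 := by rwa [hr, ← Function.iterate_succ_apply' D]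
    have hr2 : D (D r) = 0 := by
      rwa [hr, ← Function.iterate_succ_apply' D, ← Function.iterate_succ_apply' D]
    obtain ⟨hb, hb'⟩ := iterate_derivation_pow D hr1 hr2 b
    set e := D^[m + 1 + b] (d * r ^ b) with he
    have he0 : e ≠ 0 := by
      rw [he, iterate_derivation_mul_top D hm' hb']
      exact smul_ne_zero (Nat.choose_pos (by omega)).ne' (mul_ne_zero hm hb)
    have hDe : D e = 0 := by
      rw [he, ← Function.iterate_succ_apply' D]
      exact iterate_derivation_mul_eq_zero D hm' hb'
    set s := D^[m + 1 + b] g with hs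
    have hDs : D s = 0 := by rwa [hs, ← Function.iterate_succ_apply' D]
    -- The top derivatives `e` and `s` lie in the kernel, so this combination cancels the leading
    -- terms. No remainder survives the recursion, because elements of `J` of degree below `m + 1`
    -- vanish.
    obtain ⟨c, hc, hDc, u, hu⟩ := ih (e * g - s * (d * r ^ b))
      (J.sub_mem (J.mul_mem_left _ hg) (J.mul_mem_left _ (J.mul_mem_right _ hd))) (by
        rw [iterate_map_sub, iterate_derivation_mul_of_ker D hDe,
          iterate_derivation_mul_of_ker D hDs, ← he, ← hs]
        ring)
    refine ⟨c * e, mul_ne_zero hc he0, by simp [hDc, hDe], u + c * s * r ^ b, ?_⟩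
    linear_combination hu

/-- If the quotients `c / d` which are regular away from the common zeros of `t` are regular, then
the ideal generated by `t` meets the kernel of a locally nilpotent derivation. -/
theorem IsLocallyNilpotent.exists_mem_span_ker {D : Derivation K A A} (hD : IsLocallyNilpotent D)
    {t : Set A} (ht : t.Finite) (hne : ∃ g ∈ t, g ≠ 0)
    (hquot : ∀ c d : A, d ≠ 0 → (∀ g ∈ t, ∃ u, c * g = d * u) → ∃ y, d * y = c) :
    ∃ h ∈ Ideal.span t, h ≠ 0 ∧ D h = 0 := by
  classical
  set J := Ideal.span t
  have hex : ∃ m : ℕ, ∃ d ∈ J, d ≠ 0 ∧ D^[m + 1] d = 0 := by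
    obtain ⟨g, hg, hg0⟩ := hne
    obtain ⟨N, -, hN⟩ := hD.exists_top hg0
    exact ⟨N, g, Ideal.subset_span hg, hg0, hN⟩
  obtain ⟨d, hd, hd0, hdm⟩ := Nat.find_spec hex
  rcases hm : Nat.find hex with _ | m
  · rw [hm] at hdm
    exact ⟨d, hd, hd0, hdm⟩
  rw [hm] at hdm
  have hmin : ∀ g ∈ J, D^[m + 1] g = 0 → g = 0 := by
    intro g hg h
    by_contra hg0
    exact Nat.find_min hex (m := m) (by omega) ⟨g, hg, hg0, h⟩
  have htop : D^[m + 1] d ≠ 0 := fun h => hd0 (hmin d hd h)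
  have key : ∀ g ∈ t, ∃ c, c ≠ 0 ∧ D c = 0 ∧ ∃ u, c * g = d * u := by
    intro g hg
    obtain ⟨N, hN⟩ := hD g
    exact exists_ker_mul_eq D hd htop hdm hmin N g (Ideal.subset_span hg) hN
  choose! c hc hDc hu using key
  have hprod : D (∏ g ∈ ht.toFinset, c g) = 0 := by
    refine Finset.prod_induction c (fun x => D x = 0) (fun x y hx hy => by simp [hx, hy]) (by simp)
      fun g hg => hDc g (by simpa using hg)
  have hprod0 : ∏ g ∈ ht.toFinset, c g ≠ 0 :=
    Finset.prod_ne_zero_iff.2 fun g hg => hc g (by simpa using hg)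
  -- The product of the `c g` is a multiple of each of them, so it works for all generators at once;
  -- `d` then divides a nonzero kernel element and is itself in the kernel.
  obtain ⟨y, hy⟩ := hquot (∏ g ∈ ht.toFinset, c g) d hd0 (by
    intro g hg
    obtain ⟨u, hu⟩ := hu g hg
    obtain ⟨v, hv⟩ := Finset.dvd_prod_of_mem c (show g ∈ ht.toFinset by simpa using hg)
    exact ⟨u * v, by rw [hv]; linear_combination v * hu⟩)
  exact ⟨d, hd, hd0, hD.ker_of_mul (y := y) (by rwa [hy]) (by rwa [hy])⟩

end Domain

section Exp

variable [CharZero K]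

open scoped Nat

/-- The exponential of `T • D` as an algebra homomorphism into power series in `T`. -/
noncomputable def expSeries (D : Derivation K A A) : A →ₐ[K] PowerSeries A :=
  AlgHom.ofLinearMap
    { toFun := fun f => PowerSeries.mk fun k => (k ! : K)⁻¹ • D^[k] f
      map_add' := fun f g => by ext k; simp [iterate_map_add]
      map_smul' := fun c f => by
        ext k
        have : D^[k] (c • f) = c • D^[k] f := by
          induction k with
          | zero => rfl
          | succ k ih => simp [Function.iterate_succ_apply', ih]
        simp [this, smul_comm c] }
    (by
      ext k
      rcases k with _ | k
      · simp
      · have : D^[k + 1] 1 = 0 := iterate_derivation_zero_of_le D (k := 1) (by simp) (by omega)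
        simp only [LinearMap.coe_mk, AddHom.coe_mk, PowerSeries.coeff_mk, this]
        simp [PowerSeries.coeff_one])
    (fun f g => by
      ext k
      simp only [LinearMap.coe_mk, AddHom.coe_mk, PowerSeries.coeff_mk, PowerSeries.coeff_mul,
        iterate_derivation_mul, Finset.smul_sum]
      refine Finset.sum_congr rfl ?_
      rintro ⟨i, j⟩ hij
      rw [Finset.HasAntidiagonal.mem_antidiagonal] at hij
      simp only at hij
      subst hij
      rw [smul_mul_smul_comm, ← Nat.cast_smul_eq_nsmul K, smul_smul]
      congr 1
      have h := Nat.add_choose_mul_factorial_mul_factorial i j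
      have h1 : ((i + j) ! : K) ≠ 0 := by exact_mod_cast (Nat.factorial_pos _).ne'
      have h2 : (i ! : K) ≠ 0 := by exact_mod_cast (Nat.factorial_pos _).ne'
      have h3 : (j ! : K) ≠ 0 := by exact_mod_cast (Nat.factorial_pos _).ne'
      have h4 : ((i + j).choose i : K) * i ! * j ! = (i + j) ! := by
        rw [← h]; push_cast [← Nat.choose_symm_add]; ring
      field_simp
      linear_combination h4)

theorem coeff_expSeries (D : Derivation K A A) (f : A) (k : ℕ) :
    PowerSeries.coeff k (expSeries D f) = (k ! : K)⁻¹ • D^[k] f := by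
  simp [expSeries]

theorem IsLocallyNilpotent.exists_polynomial {D : Derivation K A A} (hD : IsLocallyNilpotent D)
    (f : A) : ∃ p : Polynomial A, (p : PowerSeries A) = expSeries D f := by
  obtain ⟨N, hN⟩ := hD f
  refine ⟨PowerSeries.trunc N (expSeries D f), ?_⟩
  ext k
  rw [Polynomial.coeff_coe, PowerSeries.coeff_trunc]
  split_ifs with h
  · rfl
  · rw [coeff_expSeries, iterate_derivation_zero_of_le D hN (not_lt.1 h), smul_zero]

/-- The value at `T = s` of the exponential of `T • D`, for `D` locally nilpotent. -/
noncomputable def expAt (D : Derivation K A A) (hD : IsLocallyNilpotent D) (s : K) : A →ₐ[K] A :=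
  have key := hD.exists_polynomial
  -- All homomorphism laws are checked on power series, where `expSeries` is already a homomorphism.
  have hinj := Polynomial.coe_injective A
  AlgHom.ofLinearMap
    { toFun := fun f => (key f).choose.eval (algebraMap K A s)
      map_add' := fun f g => by
        rw [← Polynomial.eval_add]
        congr 1
        apply hinj
        rw [Polynomial.coe_add, (key _).choose_spec, (key _).choose_spec, (key _).choose_spec,
          map_add]
      map_smul' := fun c f => by
        rw [RingHom.id_apply, Algebra.smul_def c (Polynomial.eval _ _), ← Polynomial.eval_C_mul]
        congr 1
        apply hinj
        rw [Polynomial.coe_mul, (key _).choose_spec, (key _).choose_spec, map_smul,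
          Algebra.smul_def]
        simp [PowerSeries.algebraMap_apply] }
    (by
      rw [LinearMap.coe_mk, AddHom.coe_mk, show (key 1).choose = 1 from hinj (by
        rw [(key _).choose_spec]; simp), Polynomial.eval_one])
    (fun f g => by
      rw [LinearMap.coe_mk, AddHom.coe_mk, ← Polynomial.eval_mul]
      congr 1
      apply hinj
      rw [Polynomial.coe_mul, (key _).choose_spec, (key _).choose_spec, (key _).choose_spec,
          map_mul])

theorem expAt_eq_eval (D : Derivation K A A) (hD : IsLocallyNilpotent D) (s : K) {f : A}
    {p : Polynomial A} (hp : (p : PowerSeries A) = expSeries D f) :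
    expAt D hD s f = p.eval (algebraMap K A s) := by
  have : p = (hD.exists_polynomial f).choose :=
    Polynomial.coe_injective A (by rw [hp, (hD.exists_polynomial f).choose_spec])
  rw [this]
  rfl

/-- The exponential of `f` is a polynomial in `T` equal to `f` at infinitely many values, so it is
constant; its coefficient of `T` is `D f`. -/
theorem eq_zero_of_expAt_eq [IsDomain A] (D : Derivation K A A) (hD : IsLocallyNilpotent D) {f : A}
    (hf : ∀ s, expAt D hD s f = f) : D f = 0 := by
  obtain ⟨p, hp⟩ := hD.exists_polynomial f
  have hpf : p = Polynomial.C f := by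
    refine Polynomial.eq_of_infinite_eval_eq _ _ ((Set.infinite_range_of_injective
      (FaithfulSMul.algebraMap_injective K A)).mono ?_)
    rintro _ ⟨s, rfl⟩
    simp [← expAt_eq_eval D hD s hp, hf s]
  have h := coeff_expSeries D f 1
  rw [← hp, hpf] at h
  simpa [Polynomial.coeff_C] using h.symm

theorem expAt_apply (D : Derivation K A A) (hD : IsLocallyNilpotent D) (s : K) {f : A} {N : ℕ}
    (hN : D^[N] f = 0) :
    expAt D hD s f = ∑ k ∈ Finset.range N, (s ^ k * (k ! : K)⁻¹) • D^[k] f := by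
  obtain ⟨p, hp⟩ := hD.exists_polynomial f
  have h := expAt_eq_eval D hD s hp
  have hc : ∀ k, p.coeff k = (k ! : K)⁻¹ • D^[k] f := fun k => by
    rw [← coeff_expSeries, ← hp, Polynomial.coeff_coe]
  have hdeg : p.natDegree < N ∨ p = 0 := by
    by_cases hp0 : p = 0
    · exact Or.inr hp0
    left
    by_contra hlt
    apply hp0
    rw [← Polynomial.leadingCoeff_eq_zero, Polynomial.leadingCoeff, hc,
      iterate_derivation_zero_of_le D hN (not_lt.1 hlt), smul_zero]
  rcases hdeg with hdeg | rfl
  · rw [h, Polynomial.eval_eq_sum_range' hdeg]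
    refine Finset.sum_congr rfl fun k _ => ?_
    rw [hc, mul_smul, Algebra.smul_def (s ^ k), map_pow, mul_comm]
  · rw [h, Polynomial.eval_zero]
    refine (Finset.sum_eq_zero fun k _ => ?_).symm
    rw [mul_smul, ← hc, Polynomial.coeff_zero, smul_zero]

theorem expAt_zero (D : Derivation K A A) (hD : IsLocallyNilpotent D) (f : A) :
    expAt D hD 0 f = f := by
  obtain ⟨N, hN⟩ := hD f
  rw [expAt_apply D hD 0 (iterate_derivation_zero_of_le D hN (Nat.le_succ N)),
    Finset.sum_range_succ']
  simp

theorem expAt_expAt (D : Derivation K A A) (hD : IsLocallyNilpotent D) (s s' : K) (f : A) :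
    expAt D hD s (expAt D hD s' f) = expAt D hD (s + s') f := by
  obtain ⟨N, hN⟩ := hD f
  have hadd : ∀ n : ℕ, ((s + s') ^ n * (n ! : K)⁻¹) • D^[n] f =
      ∑ k ∈ Finset.range (n + 1), (s ^ k * (k ! : K)⁻¹) •
        (s' ^ (n - k) * ((n - k) ! : K)⁻¹) • D^[k + (n - k)] f := by
    intro n
    rw [add_pow, Finset.sum_mul, Finset.sum_smul]
    refine Finset.sum_congr rfl fun k hk => ?_
    have hk' : k ≤ n := Nat.lt_succ_iff.1 (Finset.mem_range.1 hk)
    rw [Nat.add_sub_cancel' hk', smul_smul]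
    congr 1
    have h1 : (n ! : K) ≠ 0 := by exact_mod_cast (Nat.factorial_pos _).ne'
    have h2 : (k ! : K) ≠ 0 := by exact_mod_cast (Nat.factorial_pos _).ne'
    have h3 : ((n - k) ! : K) ≠ 0 := by exact_mod_cast (Nat.factorial_pos _).ne'
    have h4 : (n.choose k : K) * k ! * (n - k) ! = n ! := by
      exact_mod_cast Nat.choose_mul_factorial_mul_factorial hk'
    field_simp
    linear_combination s ^ k * s' ^ (n - k) * h4
  rw [expAt_apply D hD (s + s') hN, Finset.sum_congr rfl fun n _ => hadd n,
    Finset.sum_range_diag_flip N fun k l => (s ^ k * (k ! : K)⁻¹) •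
        (s' ^ l * (l ! : K)⁻¹) • D^[k + l] f,
    expAt_apply D hD s' hN, map_sum]
  have hN' : ∀ l, D^[N] (D^[l] f) = 0 := fun l => by
    rw [← Function.iterate_add_apply]
    exact iterate_derivation_zero_of_le D hN (by omega)
  simp only [map_smul, fun l => expAt_apply D hD s (hN' l), Finset.smul_sum]
  rw [Finset.sum_comm]
  refine Finset.sum_congr rfl fun k _ => ?_
  -- The square of indices exceeds the triangle `k + l < N` only by terms where the iterate of order
  -- `k + l` kills `f`.
  rw [← Finset.sum_subset (Finset.range_mono (Nat.sub_le N k))]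
  · refine Finset.sum_congr rfl fun l _ => ?_
    rw [smul_comm, Function.iterate_add_apply]
  · intro l _ hl
    rw [← Function.iterate_add_apply, iterate_derivation_zero_of_le D hN, smul_zero, smul_zero]
    rw [Finset.mem_range] at hl
    omega

end Exp

end LocallyNilpotent

/-! ### Closure properties of regular functions. -/

section RegularFunctions

variable {K : Type*} [Field K] {ι κ : Type*} {P Q : Type*}

/-- The algebra of regular functions. -/
def regularSubalgebra (e : P → ι → K) : Subalgebra K (P → K) where
  carrier := {f | IsRegularFun e f}
  mul_mem' := IsRegularFun.mul
  add_mem' := IsRegularFun.add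
  algebraMap_mem' c := by
    have := IsRegularFun.of_polynomial e (MvPolynomial.C c)
    simp only [MvPolynomial.eval_C] at this
    exact this

theorem mem_regularSubalgebra {e : P → ι → K} {f : P → K} :
    f ∈ regularSubalgebra e ↔ IsRegularFun e f :=
  Iff.rfl

theorem isRegularFun_coord (e : P → ι → K) (i : ι) : IsRegularFun e fun x => e x i := by
  simpa using IsRegularFun.of_polynomial e (MvPolynomial.X i)

theorem isRegularMap_fst (e : P → ι → K) (e' : Q → κ → K) :
    IsRegularMap (prodCoord e e') e Prod.fst :=
  fun i => isRegularFun_coord (prodCoord e e') (Sum.inl i)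

theorem isRegularMap_snd (e : P → ι → K) (e' : Q → κ → K) :
    IsRegularMap (prodCoord e e') e' Prod.snd :=
  fun i => isRegularFun_coord (prodCoord e e') (Sum.inr i)

theorem IsRegularMap.prodMk {R τ : Type*} {e : P → ι → K} {e' : Q → κ → K} {e'' : R → τ → K}
    {φ : P → Q} {ψ : P → R} (hφ : IsRegularMap e e' φ) (hψ : IsRegularMap e e'' ψ) :
    IsRegularMap e (prodCoord e' e'') fun x => (φ x, ψ x)
  | Sum.inl i => hφ i
  | Sum.inr j => hψ j

/-- The inverse of a regular function without zeros is regular. -/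
theorem IsRegularFun.inv {e : P → ι → K} {f : P → K} (hf : IsRegularFun e f)
    (h0 : ∀ x, f x ≠ 0) : IsRegularFun e fun x => (f x)⁻¹ := by
  intro x
  obtain ⟨p, q, hq, h⟩ := hf x
  have hp : MvPolynomial.eval (e x) p ≠ 0 := fun hp => h0 x (by rw [h x hq, hp, zero_div])
  refine ⟨q * q, p * q, by simp [hp, hq], fun y hy => ?_⟩
  rw [map_mul] at hy
  change (f y)⁻¹ = _
  rw [h y (right_ne_zero_of_mul hy), inv_div, map_mul, map_mul,
    mul_div_mul_right _ _ (right_ne_zero_of_mul hy)]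

end RegularFunctions

/-! ### The algebra of regular functions and the points of `X`. -/

section Variety

variable {K : Type*} [Field K] {n : ℕ} {X : Set (Fin n → K)}

/-- The algebra of regular functions on `X`. -/
abbrev RegularAlgebra (X : Set (Fin n → K)) : Subalgebra K (X → K) :=
  regularSubalgebra (Subtype.val : X → Fin n → K)

/-- The restriction of polynomials to `X`. -/
noncomputable def restrict (X : Set (Fin n → K)) : MvPolynomial (Fin n) K →ₐ[K] RegularAlgebra X :=
  MvPolynomial.aeval fun j => ⟨fun x => x.1 j, isRegularFun_coord _ j⟩

/-- The evaluation at a point. -/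
def evalAt (x : X) : RegularAlgebra X →ₐ[K] K :=
  (Pi.evalAlgHom K (fun _ => K) x).comp (RegularAlgebra X).val

theorem evalAt_apply (x : X) (f : RegularAlgebra X) : evalAt x f = f.1 x := rfl

theorem regular_ext {f g : RegularAlgebra X} (h : ∀ x, evalAt x f = evalAt x g) : f = g :=
  Subtype.ext (funext h)

theorem evalAt_restrict (x : X) (p : MvPolynomial (Fin n) K) :
    evalAt x (restrict X p) = MvPolynomial.eval x.1 p := by
  have : (evalAt x).comp (restrict X) = MvPolynomial.aeval x.1 := by
    ext j
    simp [restrict, evalAt]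
  simpa [MvPolynomial.coe_aeval_eq_eval] using
    DFunLike.congr_fun this p

/-- The coordinate functions. -/
noncomputable def coord (X : Set (Fin n → K)) (j : Fin n) : RegularAlgebra X :=
  restrict X (MvPolynomial.X j)

theorem evalAt_coord (x : X) (j : Fin n) : evalAt x (coord X j) = x.1 j := by
  simp [coord, evalAt_restrict]

/-- The extra factor `q` turns the local equation `f * q = p` into a global one: where `q` vanishes,
both sides are zero. -/
theorem exists_mul_restrict_eq (f : RegularAlgebra X) (x : X) :
    ∃ p q : MvPolynomial (Fin n) K, MvPolynomial.eval x.1 q ≠ 0 ∧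
      restrict X q * (f * restrict X q - restrict X p) = 0 := by
  obtain ⟨p, q, hq, h⟩ := f.2 x
  refine ⟨p, q, hq, regular_ext fun y => ?_⟩
  simp only [map_mul, map_sub, evalAt_restrict, map_zero]
  by_cases hy : MvPolynomial.eval y.1 q = 0
  · simp [hy]
  · rw [evalAt_apply, h y hy]
    field_simp
    ring

theorem isOpen_zariski_compl_zeros (p : MvPolynomial (Fin n) K) :
    @IsOpen _ (zariski K n) {x | MvPolynomial.eval x p ≠ 0} :=
  ⟨{p}, by ext x; simp⟩

theorem IsIrredQuasiAffine.exists_ne_zero (hX : IsIrredQuasiAffine X) {p q : MvPolynomial (Fin n) K}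
    (hp : ∃ x : X, MvPolynomial.eval x.1 p ≠ 0) (hq : ∃ x : X, MvPolynomial.eval x.1 q ≠ 0) :
    ∃ x : X, MvPolynomial.eval x.1 p ≠ 0 ∧ MvPolynomial.eval x.1 q ≠ 0 := by
  obtain ⟨x, hx⟩ := hp
  obtain ⟨y, hy⟩ := hq
  obtain ⟨z, hz, hz'⟩ := hX.irreducible.2 _ _ (isOpen_zariski_compl_zeros p)
    (isOpen_zariski_compl_zeros q) ⟨x, x.2, hx⟩ ⟨y, y.2, hy⟩
  exact ⟨⟨z, hz⟩, hz'⟩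

theorem IsIrredQuasiAffine.nonempty (hX : IsIrredQuasiAffine X) : Nonempty X :=
  hX.irreducible.1.to_subtype

theorem IsRegularFun.exists_polynomial_ne_zero {P ι : Type*} {e : P → ι → K} {f : P → K}
    (hf : IsRegularFun e f) {x : P} (hx : f x ≠ 0) : ∃ p : MvPolynomial ι K,
      MvPolynomial.eval (e x) p ≠ 0 ∧ ∀ y, MvPolynomial.eval (e y) p ≠ 0 → f y ≠ 0 := by
  obtain ⟨p, q, hq, h⟩ := hf x
  refine ⟨p * q, ?_, fun y hy => ?_⟩
  · rw [map_mul]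
    refine mul_ne_zero (fun hp => hx ?_) hq
    rw [h x hq, hp, zero_div]
  · rw [map_mul] at hy
    rw [h y (right_ne_zero_of_mul hy)]
    exact div_ne_zero (left_ne_zero_of_mul hy) (right_ne_zero_of_mul hy)

theorem IsIrredQuasiAffine.isDomain (hX : IsIrredQuasiAffine X) : IsDomain (RegularAlgebra X) := by
  have := hX.nonempty
  have : Nontrivial (RegularAlgebra X) :=
    (evalAt (Classical.arbitrary X)).toRingHom.domain_nontrivial
  have : NoZeroDivisors (RegularAlgebra X) := by
    refine ⟨fun {f g} hfg => ?_⟩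
    by_contra! hne
    have h1 : ∀ f : RegularAlgebra X, f ≠ 0 → ∃ x, f.1 x ≠ 0 := fun f hf => by
      by_contra! h
      exact hf (regular_ext h)
    obtain ⟨x, hx⟩ := h1 f hne.1
    obtain ⟨y, hy⟩ := h1 g hne.2
    obtain ⟨p, hp, hp'⟩ := f.2.exists_polynomial_ne_zero hx
    obtain ⟨q, hq, hq'⟩ := g.2.exists_polynomial_ne_zero hy
    obtain ⟨z, hz, hz'⟩ := hX.exists_ne_zero ⟨x, hp⟩ ⟨y, hq⟩
    have := congrArg (evalAt z) hfg
    rw [map_mul, map_zero] at this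
    exact mul_ne_zero (hp' z hz) (hq' z hz') this
  exact NoZeroDivisors.to_isDomain _

/-- A derivation of the algebra of regular functions is determined by the coordinates. -/
theorem IsIrredQuasiAffine.derivation_eq_zero (hX : IsIrredQuasiAffine X)
    (D : Derivation K (RegularAlgebra X) (RegularAlgebra X)) (hD : ∀ j, D (coord X j) = 0) :
    D = 0 := by
  have := hX.isDomain
  have hpoly : ∀ p, D (restrict X p) = 0 := by
    intro p
    induction p using MvPolynomial.induction_on with
    | C a => rw [← MvPolynomial.algebraMap_eq, AlgHom.commutes, D.map_algebraMap]
    | add p q hp hq => rw [map_add, map_add, hp, hq, add_zero]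
    | mul_X p j hp =>
      rw [map_mul, Derivation.leibniz, hp, show restrict X (MvPolynomial.X j) = coord X j from rfl,
        hD j, smul_zero, smul_zero, add_zero]
  ext1 f
  obtain ⟨x⟩ := hX.nonempty
  obtain ⟨p, q, hq, h⟩ := exists_mul_restrict_eq f x
  have hq0 : restrict X q ≠ 0 := fun h0 => hq (by rw [← evalAt_restrict, h0, map_zero])
  have h1 := congrArg D (sub_eq_zero.1 ((mul_eq_zero.1 h).resolve_left hq0))
  rw [Derivation.leibniz, hpoly, hpoly, smul_zero, zero_add, smul_eq_mul] at h1
  exact (mul_eq_zero.1 h1).resolve_left hq0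

/-- Noetherianity makes `t` finite, which is needed later to multiply over generators of the
boundary ideal. -/
theorem exists_finset_of_isLocallyClosed (hX : @IsLocallyClosed _ (zariski K n) X) :
    ∃ (S : Set (MvPolynomial (Fin n) K)) (t : Finset (MvPolynomial (Fin n) K)),
      ∀ x, x ∈ X ↔ (∀ p ∈ S, MvPolynomial.eval x p = 0) ∧ ∃ f ∈ t, MvPolynomial.eval x f ≠ 0 := by
  obtain ⟨U, Z, ⟨S', hS'⟩, hZ, rfl⟩ := hX
  obtain ⟨S, hS⟩ : Zᶜᶜ ∈ _ := @IsClosed.isOpen_compl _ (zariski K n) _ hZ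
  obtain ⟨t, ht⟩ := (inferInstance : IsNoetherian _ _).noetherian (Ideal.span S')
  refine ⟨S, t, fun x => ?_⟩
  rw [compl_compl] at hS
  have h1 : (∀ p ∈ S', MvPolynomial.eval x p = 0) ↔ ∀ p ∈ t, MvPolynomial.eval x p = 0 := by
    have : ∀ s : Set (MvPolynomial (Fin n) K), (∀ p ∈ s, MvPolynomial.eval x p = 0) ↔
        Ideal.span s ≤ RingHom.ker (MvPolynomial.eval x) := fun s => by
      rw [Ideal.span_le]
      rfl
    rw [this, ← ht]
    exact (this t).symm
  have h2 : x ∈ U ↔ ¬ x ∈ Uᶜ := by simp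
  rw [Set.mem_inter_iff, h2, hS', hS, Set.mem_ofPred_eq, Set.mem_ofPred_eq, h1, and_comm]
  push Not
  rfl

/-- A homomorphism from the algebra of regular functions to the ground field which does not kill
the ideal of the boundary is the evaluation at a point. -/
theorem exists_point {S : Set (MvPolynomial (Fin n) K)} {t : Finset (MvPolynomial (Fin n) K)}
    (hX : ∀ x, x ∈ X ↔
      (∀ p ∈ S, MvPolynomial.eval x p = 0) ∧ ∃ f ∈ t, MvPolynomial.eval x f ≠ 0)
    (φ : RegularAlgebra X →ₐ[K] K) (hφ : ∃ f ∈ t, φ (restrict X f) ≠ 0) :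
    ∃ y : X, ∀ f, φ f = evalAt y f := by
  have heval : ∀ p, φ (restrict X p) = MvPolynomial.eval (fun j => φ (coord X j)) p := by
    have : φ.comp (restrict X) = MvPolynomial.aeval fun j => φ (coord X j) := by
      ext j
      simp [coord]
    intro p
    simpa [MvPolynomial.coe_aeval_eq_eval] using
    DFunLike.congr_fun this p
  have hy : (fun j => φ (coord X j)) ∈ X := by
    refine (hX _).2 ⟨fun p hp => ?_, ?_⟩
    · rw [← heval, show restrict X p = 0 from regular_ext fun x => ?_, map_zero]
      rw [evalAt_restrict, map_zero, ((hX x.1).1 x.2).1 p hp]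
    · simpa only [heval] using hφ
  refine ⟨⟨_, hy⟩, fun f => ?_⟩
  -- Both homomorphisms agree on polynomials, and `q` does not vanish at the new point, so `f * q =
  -- p` determines the value on `f`.
  obtain ⟨p, q, hq, h⟩ := exists_mul_restrict_eq f ⟨_, hy⟩
  have h1 := congrArg φ h
  have h2 := congrArg (evalAt ⟨_, hy⟩) h
  simp only [map_mul, map_sub, map_zero, heval, evalAt_restrict, mul_eq_zero, hq, false_or] at h1 h2
  exact mul_right_cancel₀ hq (by rw [sub_eq_zero.1 h1, sub_eq_zero.1 h2])

end Variety

/-! ### Rigidity excludes locally nilpotent derivations. -/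

section Rigid

variable {K : Type*} [Field K] {n : ℕ} {X : Set (Fin n → K)}

theorem IsIrredQuasiAffine.charZero [CharZero K] (hX : IsIrredQuasiAffine X) :
    CharZero (RegularAlgebra X) :=
  have := hX.isDomain
  charZero_of_injective_algebraMap (algebraMap K (RegularAlgebra X)).injective

/-- A function which is, near each point, a quotient by one of the functions in `t` of a regular
function is regular. -/
theorem exists_quotient (hX : IsIrredQuasiAffine X)
    {t : Set (RegularAlgebra X)} (ht : ∀ x, ∃ f ∈ t, evalAt x f ≠ 0) {c d : RegularAlgebra X}
    (hd : d ≠ 0) (h : ∀ f ∈ t, ∃ u, c * f = d * u) : ∃ y, d * y = c := by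
  have := hX.isDomain
  choose! u hu using h
  choose F hF hF0 using ht
  -- The quotient sought is `u f / f` wherever `f ≠ 0`; these relations glue the local expressions.
  have hcross : ∀ f ∈ t, ∀ g ∈ t, u f * g = u g * f := fun f hf g hg =>
    mul_left_cancel₀ hd (by linear_combination f * hu g hg - g * hu f hf)
  have hval : ∀ f ∈ t, ∀ x, evalAt x f ≠ 0 →
      evalAt x (u (F x)) / evalAt x (F x) = evalAt x (u f) / evalAt x f := fun f hf x hx => by
    rw [div_eq_div_iff (hF0 x) hx, ← map_mul, ← map_mul, hcross _ (hF x) _ hf]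
  have hreg : IsRegularFun (Subtype.val : X → Fin n → K)
      fun x => evalAt x (u (F x)) / evalAt x (F x) := by
    intro x
    obtain ⟨a, b, hb, hab⟩ := (u (F x)).2 x
    obtain ⟨p, q, hq, hpq⟩ := (F x).2 x
    have hp : MvPolynomial.eval x.1 p ≠ 0 := fun h0 => hF0 x (by
      rw [evalAt_apply, hpq x hq, h0, zero_div])
    refine ⟨a * q * q, b * p * q, by simp [hb, hp, hq], fun y hy => ?_⟩
    simp only [map_mul] at hy
    have hyq := right_ne_zero_of_mul hy
    have hyp := right_ne_zero_of_mul (left_ne_zero_of_mul hy)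
    have hyb := left_ne_zero_of_mul (left_ne_zero_of_mul hy)
    have hFy : evalAt y (F x) ≠ 0 := by
      rw [evalAt_apply, hpq y hyq]
      exact div_ne_zero hyp hyq
    simp only [hval _ (hF x) y hFy, map_mul]
    rw [evalAt_apply, evalAt_apply, hab y hyb, hpq y hyq]
    field_simp
  refine ⟨⟨_, hreg⟩, regular_ext fun x => ?_⟩
  rw [map_mul, evalAt_apply x ⟨_, hreg⟩, ← mul_div_assoc, div_eq_iff (hF0 x), ← map_mul, ← map_mul,
    hu _ (hF x)]

theorem point_ext {x y : X} (h : ∀ f, evalAt x f = evalAt y f) : x = y :=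
  Subtype.ext (funext fun j => by simpa [evalAt_coord] using h (coord X j))

variable [CharZero K]

/-- A locally nilpotent derivation whose exponential moves points of `X` to points of `X`
integrates to an action of the additive group. -/
theorem exists_gaAction {D : Derivation K (RegularAlgebra X) (RegularAlgebra X)}
    (hD : IsLocallyNilpotent D)
    (hpt : ∀ (s : K) (x : X), ∃ y : X, ∀ f, evalAt x (expAt D hD s f) = evalAt y f) :
    ∃ ρ : Multiplicative K →* Aut X, IsRegularAction (gaCoord K) ρ ∧
      ∀ s x f, evalAt x (expAt D hD s f) =
        evalAt ((ρ (Multiplicative.ofAdd s) : Equiv.Perm X) x) f := by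
  choose α hα using hpt
  have hadd : ∀ s s' x, α s (α s' x) = α (s + s') x := fun s s' x => point_ext fun f => by
    rw [← hα, ← hα, ← hα, expAt_expAt, add_comm]
  have hzero : ∀ x, α 0 x = x := fun x => point_ext fun f => by rw [← hα, expAt_zero]
  have hreg : ∀ s, IsRegularMap (Subtype.val : X → Fin n → K) Subtype.val (α s) := by
    intro s j
    have : (fun x => (α s x).1 j) = (expAt D hD s (coord X j)).1 := by
      funext x
      rw [← evalAt_coord, ← hα, evalAt_apply]
    rw [this]
    exact (expAt D hD s (coord X j)).2
  refine ⟨MonoidHom.mk' (fun s => ⟨⟨α s.toAdd, α (-s.toAdd), fun x => ?_, fun x => ?_⟩, ?_, ?_⟩)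
    fun s s' => ?_, ?_, fun s x f => hα s x f⟩
  · rw [hadd, neg_add_cancel, hzero]
  · rw [hadd, add_neg_cancel, hzero]
  · exact hreg _
  · exact hreg _
  · refine Subtype.ext (Equiv.ext fun x => ?_)
    exact (hadd s.toAdd s'.toAdd x).symm
  · intro j
    -- Local nilpotency makes the `j`-th coordinate of the action a polynomial in `s` with regular
    -- coefficients.
    obtain ⟨N, hN⟩ := hD (coord X j)
    set e := prodCoord (gaCoord K) (Subtype.val : X → Fin n → K)
    have hs : (fun z : Multiplicative K × X => z.1.toAdd) ∈ regularSubalgebra e :=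
      isRegularFun_coord e (Sum.inl ())
    have hf : ∀ f : RegularAlgebra X, (fun z : Multiplicative K × X => f.1 z.2) ∈
        regularSubalgebra e := fun f => f.2.comp (isRegularMap_snd _ _)
    have hsum := (regularSubalgebra e).sum_mem (t := Finset.range N) fun k _ =>
      (regularSubalgebra e).mul_mem ((regularSubalgebra e).smul_mem
        ((regularSubalgebra e).pow_mem hs k) (k.factorial : K)⁻¹) (hf (D^[k] (coord X j)))
    rw [mem_regularSubalgebra] at hsum
    convert hsum using 1
    funext z
    change (α z.1.toAdd z.2).1 j = _
    rw [← evalAt_coord, ← hα, expAt_apply D hD _ hN, map_sum, Finset.sum_apply]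
    refine Finset.sum_congr rfl fun k _ => ?_
    simp only [map_smul, smul_eq_mul, Pi.mul_apply, Pi.smul_apply, Pi.pow_apply, evalAt_apply]
    ring

/-- A rigid irreducible quasiaffine variety admits no nonzero locally nilpotent derivation of the
algebra of regular functions. -/
theorem IsRigid.eq_zero_of_isLocallyNilpotent (hX : IsIrredQuasiAffine X) (hr : IsRigid X)
    {D : Derivation K (RegularAlgebra X) (RegularAlgebra X)} (hD : IsLocallyNilpotent D) :
    D = 0 := by
  classical
  have := hX.isDomain
  have := hX.charZero
  obtain ⟨S, t, hSt⟩ := exists_finset_of_isLocallyClosed hX.locallyClosed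
  have hne : ∀ x : X, ∃ f ∈ restrict X '' t, evalAt x f ≠ 0 := fun x => by
    obtain ⟨f, hf, hf0⟩ := ((hSt x.1).1 x.2).2
    exact ⟨_, ⟨f, hf, rfl⟩, by rwa [evalAt_restrict]⟩
  obtain ⟨h, hmem, h0, hDh⟩ := hD.exists_mem_span_ker (t.finite_toSet.image (restrict X))
    (by
      obtain ⟨x⟩ := hX.nonempty
      obtain ⟨f, hf, hf0⟩ := hne x
      exact ⟨f, hf, fun h => hf0 (by rw [h, map_zero])⟩)
    (fun c d hd hcd => exists_quotient hX hne hd hcd)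
  have hiter : ∀ k f, (h • D)^[k] f = h ^ k * D^[k] f := by
    intro k f
    induction k with
    | zero => simp
    | succ k ih =>
      rw [Function.iterate_succ_apply', Function.iterate_succ_apply', ih, Derivation.smul_apply,
        Derivation.leibniz, Derivation.leibniz_pow, hDh]
      simp only [smul_eq_mul, mul_zero, smul_zero, add_zero]
      ring
  have hE : IsLocallyNilpotent (h • D) := fun f => by
    obtain ⟨N, hN⟩ := hD f
    exact ⟨N, by rw [hiter, hN, mul_zero]⟩
  have hpt : ∀ (s : K) (x : X), ∃ y : X, ∀ f, evalAt x (expAt (h • D) hE s f) = evalAt y f := by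
    intro s x
    by_cases hx : evalAt x h = 0
    · refine ⟨x, fun f => ?_⟩
      obtain ⟨N, hN⟩ := hE f
      rw [expAt_apply _ hE s (iterate_derivation_zero_of_le _ hN (Nat.le_succ N)),
        Finset.sum_range_succ', map_add, map_sum, Finset.sum_eq_zero]
      · simp
      · intro k _
        rw [hiter, map_smul, map_mul, map_pow, hx]
        simp
    · refine exists_point hSt ((evalAt x).comp (expAt (h • D) hE s)) ?_
      -- A homomorphism killing all of `t` would kill `h`, which lies in the ideal they generate;
      -- but the exponential fixes `h`, and `h` is nonzero at `x`.
      by_contra! hall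
      apply hx
      have h1 : expAt (h • D) hE s h = h := by
        rw [expAt_apply _ hE s (N := 1) (by simp [hDh])]
        simp
      have h2 : Ideal.span (restrict X '' t) ≤
          RingHom.ker ((evalAt x).comp (expAt (h • D) hE s)) := by
        rw [Ideal.span_le]
        rintro _ ⟨f, hf, rfl⟩
        exact hall f hf
      have h3 := h2 hmem
      rwa [RingHom.mem_ker, AlgHom.comp_apply, h1] at h3
  obtain ⟨ρ, hρ, hρf⟩ := exists_gaAction hE hpt
  have hρ1 := hr ρ hρ
  ext1 f
  have h1 : (h • D) f = 0 := eq_zero_of_expAt_eq _ hE fun s => regular_ext fun x => by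
    rw [hρf, hρ1]
    rfl
  rw [Derivation.smul_apply, smul_eq_mul] at h1
  exact (mul_eq_zero.1 h1).resolve_left h0

end Rigid

/-! ### Gradings, Euler derivations and homogeneous components. -/

section Gradings

open GradedAlgebra

variable {K A : Type*} [Field K] [CommRing A] [Algebra K A] (𝒜 : ℤ → Submodule K A)
  [GradedAlgebra 𝒜]

theorem proj_mem (i : ℤ) (f : A) : proj 𝒜 i f ∈ 𝒜 i :=
  (DirectSum.decompose 𝒜 f i).2

theorem proj_of_mem {i : ℤ} {f : A} (hf : f ∈ 𝒜 i) : proj 𝒜 i f = f :=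
  DirectSum.decompose_of_mem_same 𝒜 hf

theorem proj_of_mem_ne {i j : ℤ} {f : A} (hf : f ∈ 𝒜 i) (hij : i ≠ j) : proj 𝒜 j f = 0 :=
  DirectSum.decompose_of_mem_ne 𝒜 hf hij

theorem exists_finset_proj (f : A) :
    ∃ s : Finset ℤ, (∀ i, proj 𝒜 i f ≠ 0 → i ∈ s) ∧ ∑ i ∈ s, proj 𝒜 i f = f := by
  classical
  refine ⟨(DirectSum.decompose 𝒜 f).support, fun i hi => ?_, DirectSum.sum_support_decompose 𝒜 f⟩
  rw [DFinsupp.mem_support_iff]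
  intro h0
  exact hi (by rw [proj_apply, h0, ZeroMemClass.coe_zero])

/-- The linear map given by `φ i` on the component of degree `i`. -/
noncomputable def gradedLift (φ : ℤ → A →ₗ[K] A) : A →ₗ[K] A :=
  (DirectSum.toModule K ℤ A fun i => (φ i).comp (𝒜 i).subtype).comp
    (DirectSum.decomposeLinearEquiv 𝒜).toLinearMap

theorem gradedLift_of_mem (φ : ℤ → A →ₗ[K] A) {i : ℤ} {f : A} (hf : f ∈ 𝒜 i) :
    gradedLift 𝒜 φ f = φ i f := by
  lift f to 𝒜 i using hf
  simp [gradedLift]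

theorem leibniz_of_homogeneous (L : A →ₗ[K] A)
    (h : ∀ i j, ∀ a ∈ 𝒜 i, ∀ b ∈ 𝒜 j, L (a * b) = a • L b + b • L a) (a b : A) :
    L (a * b) = a • L b + b • L a := by
  induction a using DirectSum.Decomposition.inductionOn 𝒜 with
  | zero => simp
  | add a a' ha ha' => rw [add_mul, map_add, ha, ha', map_add, smul_add, add_smul]; abel
  | homogeneous a =>
    induction b using DirectSum.Decomposition.inductionOn 𝒜 with
    | zero => simp
    | add b b' hb hb' => rw [mul_add, map_add, hb, hb', map_add, smul_add, add_smul]; abel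
    | homogeneous b => exact h _ _ _ a.2 _ b.2

/-- The Euler derivation of a grading: it multiplies the elements of degree `i` by `i`. -/
noncomputable def euler : Derivation K A A :=
  Derivation.mk' (gradedLift 𝒜 fun i => (i : K) • LinearMap.id)
    (leibniz_of_homogeneous 𝒜 _ fun i j a ha b hb => by
      rw [gradedLift_of_mem 𝒜 _ ha, gradedLift_of_mem 𝒜 _ hb,
        gradedLift_of_mem 𝒜 _ (SetLike.mul_mem_graded ha hb)]
      change ((i + j : ℤ) : K) • (a * b) = a * ((j : K) • b) + b * ((i : K) • a)
      simp only [Algebra.smul_def]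
      push_cast [map_add]
      ring)

theorem euler_of_mem {i : ℤ} {f : A} (hf : f ∈ 𝒜 i) : euler 𝒜 f = (i : K) • f :=
  gradedLift_of_mem 𝒜 _ hf

theorem proj_euler (i : ℤ) (f : A) : proj 𝒜 i (euler 𝒜 f) = (i : K) • proj 𝒜 i f := by
  induction f using DirectSum.Decomposition.inductionOn 𝒜 with
  | zero => simp only [map_zero, smul_zero]
  | add a b ha hb => rw [map_add, map_add, map_add, ha, hb, smul_add]
  | @homogeneous j a =>
    rw [euler_of_mem 𝒜 a.2, map_smul]
    by_cases h : j = i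
    · subst h
      rfl
    · rw [proj_of_mem_ne 𝒜 a.2 h, smul_zero, smul_zero]

/-- Comparing components gives `(c - i) • proj 𝒜 i f = 0` for each `i`, and some component of `f` is
nonzero. -/
theorem exists_int_of_euler_eq {c : K} {f : A} (hf0 : f ≠ 0) (hf : euler 𝒜 f = c • f) :
    ∃ i : ℤ, c = i := by
  obtain ⟨s, -, hs⟩ := exists_finset_proj 𝒜 f
  by_contra! hc
  apply hf0
  rw [← hs]
  refine Finset.sum_eq_zero fun i _ => ?_
  have h := proj_euler 𝒜 i f
  rw [hf, map_smul, ← sub_eq_zero, ← sub_smul] at h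
  exact (smul_eq_zero.1 h).resolve_left (sub_ne_zero.2 (hc i))

theorem mem_of_euler_eq [CharZero K] {i : ℤ} {f : A} (hf : euler 𝒜 f = (i : K) • f) :
    f ∈ 𝒜 i := by
  obtain ⟨s, -, hs⟩ := exists_finset_proj 𝒜 f
  rw [← hs]
  refine Submodule.sum_mem _ fun j _ => ?_
  by_cases hij : i = j
  · subst hij
    exact proj_mem 𝒜 i f
  have h := proj_euler 𝒜 j f
  rw [hf, map_smul, ← sub_eq_zero, ← sub_smul] at h
  rw [(smul_eq_zero.1 h).resolve_left (sub_ne_zero.2 (by exact_mod_cast hij))]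
  exact zero_mem _

/-- The component of degree `l` of a derivation. -/
noncomputable def component (D : Derivation K A A) (l : ℤ) : Derivation K A A :=
  Derivation.mk' (gradedLift 𝒜 fun i => (proj 𝒜 (i + l)).comp D.toLinearMap)
    (leibniz_of_homogeneous 𝒜 _ fun i j a ha b hb => by
      rw [gradedLift_of_mem 𝒜 _ ha, gradedLift_of_mem 𝒜 _ hb,
        gradedLift_of_mem 𝒜 _ (SetLike.mul_mem_graded ha hb)]
      change proj 𝒜 (i + j + l) (D (a * b)) =
        a * proj 𝒜 (j + l) (D b) + b * proj 𝒜 (i + l) (D a)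
      simp only [Derivation.leibniz, map_add, smul_eq_mul, proj_apply]
      rw [add_assoc, DirectSum.coe_decompose_mul_add_of_left_mem 𝒜 ha, ← add_assoc, add_comm i j,
        add_assoc, DirectSum.coe_decompose_mul_add_of_left_mem 𝒜 hb])

theorem component_of_mem (D : Derivation K A A) (l : ℤ) {i : ℤ} {f : A} (hf : f ∈ 𝒜 i) :
    component 𝒜 D l f = proj 𝒜 (i + l) (D f) :=
  gradedLift_of_mem 𝒜 _ hf

theorem proj_derivation_of_mem (D : Derivation K A A) (m : ℤ) {i : ℤ} {f : A} (hf : f ∈ 𝒜 i) :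
    proj 𝒜 m (D f) = component 𝒜 D (m - i) f := by
  rw [component_of_mem 𝒜 D _ hf, add_sub_cancel]

/-- Applied to finitely many elements that determine derivations, this leaves only finitely many
nonzero components, so an extreme one exists. -/
theorem finite_component_ne_zero (D : Derivation K A A) (f : A) :
    {l | component 𝒜 D l f ≠ 0}.Finite := by
  obtain ⟨s, -, hs⟩ := exists_finset_proj 𝒜 f
  have hfin : ∀ g i, {l | proj 𝒜 (i + l) g ≠ 0}.Finite := fun g i => by
    obtain ⟨u, hu, -⟩ := exists_finset_proj 𝒜 g
    exact (u.finite_toSet.preimage (f := fun l => i + l)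
      (add_right_injective i).injOn).subset fun l hl => hu _ hl
  refine (s.finite_toSet.biUnion fun i _ => hfin (D (proj 𝒜 i f)) i).subset fun l hl => ?_
  by_contra hn
  apply hl
  rw [← hs, map_sum]
  refine Finset.sum_eq_zero fun i hi => ?_
  rw [component_of_mem 𝒜 D l (proj_mem 𝒜 i f)]
  by_contra h0
  exact hn (Set.mem_biUnion hi h0)

/-- The iterates of the extreme component of a derivation are the extreme components of its
iterates. -/
theorem proj_iterate_extreme (D : Derivation K A A) {ε l₀ : ℤ}
    (hε : ε ≠ 0) (hl : ∀ l, component 𝒜 D l ≠ 0 → ε * l ≤ ε * l₀) {k : ℤ} {f : A} (hf : f ∈ 𝒜 k)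
    (s : ℕ) : (∀ m, proj 𝒜 m (D^[s] f) ≠ 0 → ε * m ≤ ε * (k + s * l₀)) ∧
      proj 𝒜 (k + s * l₀) (D^[s] f) = (component 𝒜 D l₀)^[s] f := by
  induction s with
  | zero =>
    simp only [Function.iterate_zero, id, CharP.cast_eq_zero, zero_mul, add_zero]
    refine ⟨fun m hm => ?_, proj_of_mem 𝒜 hf⟩
    by_contra hlt
    refine hm (proj_of_mem_ne 𝒜 hf ?_)
    rintro rfl
    exact hlt le_rfl
  | succ s ih =>
    simp only [Function.iterate_succ_apply', ← ih.2]
    generalize D^[s] f = g at ih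
    obtain ⟨ih1, -⟩ := ih
    obtain ⟨u, hu, hus⟩ := exists_finset_proj 𝒜 g
    have hsum : ∀ m, proj 𝒜 m (D g) = ∑ i ∈ u, component 𝒜 D (m - i) (proj 𝒜 i g) := by
      intro m
      conv_lhs => rw [← hus, map_sum, map_sum]
      exact Finset.sum_congr rfl fun i _ => proj_derivation_of_mem 𝒜 D m (proj_mem 𝒜 i g)
    -- Only the sign of `ε` matters: it treats highest and lowest components together.
    have hterm : ∀ m i, component 𝒜 D (m - i) (proj 𝒜 i g) ≠ 0 →
        ε * (m - i) ≤ ε * l₀ ∧ ε * i ≤ ε * (k + s * l₀) := by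
      intro m i h
      refine ⟨hl _ fun h0 => h (by rw [h0, Derivation.zero_apply]), ih1 _ fun h0 => h (by
        rw [h0, map_zero])⟩
    constructor
    · intro m hm
      rw [hsum] at hm
      obtain ⟨i, -, hi⟩ := Finset.exists_ne_zero_of_sum_ne_zero hm
      obtain ⟨h1, h2⟩ := hterm m i hi
      push_cast
      linarith
    -- In the extreme degree both bounds of `hterm` must be equalities, which leaves a single term.
    · rw [hsum, Finset.sum_eq_single (k + s * l₀)]
      · congr 2
        push_cast
        ring
      · intro i _ hi
        by_contra h
        obtain ⟨h1, h2⟩ := hterm _ i h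
        push_cast at h1
        exact hi (mul_left_cancel₀ hε (by linarith))
      · intro h
        rw [show proj 𝒜 (k + s * l₀) g = 0 from not_not.1 fun h0 => h (hu _ h0), map_zero]

variable (ℬ : ℤ → Submodule K A) [GradedAlgebra ℬ]

theorem iterate_euler (s : ℕ) (f : A) {u : Finset ℤ} (hu : ∑ i ∈ u, proj ℬ i f = f) :
    (euler ℬ)^[s] f = ∑ i ∈ u, ((i : K) ^ s) • proj ℬ i f := by
  induction s with
  | zero => simpa using hu.symm
  | succ s ih =>
    rw [Function.iterate_succ_apply', ih, map_sum]
    refine Finset.sum_congr rfl fun i _ => ?_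
    rw [(euler ℬ).map_smul, euler_of_mem ℬ (proj_mem ℬ i f), smul_smul, pow_succ]

/-- An extreme component of nonzero degree of an Euler derivation is locally nilpotent. -/
theorem isLocallyNilpotent_extreme {ε l₀ : ℤ} (hl₀ : 0 < ε * l₀)
    (hl : ∀ l, component 𝒜 (euler ℬ) l ≠ 0 → ε * l ≤ ε * l₀) :
    IsLocallyNilpotent (component 𝒜 (euler ℬ) l₀) := by
  have hε : ε ≠ 0 := left_ne_zero_of_mul hl₀.ne'
  intro f
  induction f using DirectSum.Decomposition.inductionOn 𝒜 with
  | zero => exact ⟨0, rfl⟩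
  | add a b ha hb =>
    obtain ⟨N, hN⟩ := ha
    obtain ⟨M, hM⟩ := hb
    refine ⟨max N M, ?_⟩
    rw [iterate_map_add, iterate_derivation_zero_of_le _ hN (le_max_left _ _),
      iterate_derivation_zero_of_le _ hM (le_max_right _ _), add_zero]
  | @homogeneous k f =>
    obtain ⟨u, -, hu⟩ := exists_finset_proj ℬ (f : A)
    choose v hv _ using fun i => exists_finset_proj 𝒜 (proj ℬ i (f : A))
    -- Every iterate combines the same finitely many `ℬ`-components of `f`, so the `𝒜`-degrees that
    -- occur lie in one finite set.
    have hmem : ∀ s m, proj 𝒜 m ((euler ℬ)^[s] (f : A)) ≠ 0 → m ∈ u.biUnion v := by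
      intro s m hm
      rw [iterate_euler ℬ s _ hu, map_sum] at hm
      obtain ⟨i, hi, hi0⟩ := Finset.exists_ne_zero_of_sum_ne_zero hm
      rw [map_smul] at hi0
      exact Finset.mem_biUnion.2 ⟨i, hi, hv i _ (right_ne_zero_of_smul hi0)⟩
    obtain ⟨M, hM⟩ := ((u.biUnion v).image fun m => ε * m).bddAbove
    -- As `ε * l₀ ≥ 1`, after this many steps `ε` times the degree exceeds the bound `M`.
    refine ⟨(M - ε * k + 1).toNat, ?_⟩
    rw [← (proj_iterate_extreme 𝒜 _ hε hl f.2 _).2]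
    by_contra h
    have h1 := hM (Finset.mem_coe.2 (Finset.mem_image_of_mem _ (hmem _ _ h)))
    have h2 := Int.self_le_toNat (M - ε * k + 1)
    nlinarith

/-- If `A` has no nonzero locally nilpotent derivations, then the components of a grading are
stable under the Euler derivation of any other grading. -/
theorem euler_mem_of_mem (hLND : ∀ D : Derivation K A A, IsLocallyNilpotent D → D = 0)
    {t : Set A} (ht : t.Finite) (hdet : ∀ D : Derivation K A A, (∀ x ∈ t, D x = 0) → D = 0)
    {i : ℤ} {f : A} (hf : f ∈ 𝒜 i) : euler ℬ f ∈ 𝒜 i := by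
  have hfin : {l | component 𝒜 (euler ℬ) l ≠ 0}.Finite := by
    refine (ht.biUnion fun x _ => finite_component_ne_zero 𝒜 (euler ℬ) x).subset fun l hl => ?_
    by_contra hn
    refine hl (hdet _ fun x hx => ?_)
    by_contra h0
    exact hn (Set.mem_biUnion hx h0)
  have hzero : ∀ l, l ≠ 0 → component 𝒜 (euler ℬ) l = 0 := by
    intro l hl
    by_contra h0
    -- Taking `ε = l` selects the extreme component on the side of `l`; its degree is nonzero
    -- because `l * l₀ ≥ l * l > 0`.
    obtain ⟨l₀, hl₀, hmax⟩ := Set.exists_max_image _ (fun m => l * m) hfin ⟨l, h0⟩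
    have hpos : 0 < l * l₀ := lt_of_lt_of_le (mul_self_pos.2 hl) (hmax l h0)
    exact hl₀ (hLND _ (isLocallyNilpotent_extreme 𝒜 ℬ hpos hmax))
  obtain ⟨s, -, hs⟩ := exists_finset_proj 𝒜 (euler ℬ f)
  rw [← hs]
  refine Submodule.sum_mem _ fun m _ => ?_
  by_cases hm : m = i
  · subst hm
    exact proj_mem 𝒜 _ _
  · rw [proj_derivation_of_mem 𝒜 _ m hf, hzero _ (sub_ne_zero.2 hm), Derivation.zero_apply]
    exact zero_mem _

/-- The Euler derivation of `ℬ` preserves the components of `𝒜`, so it commutes with their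
projections, and in characteristic zero its eigenspaces for integers are the components of `ℬ`. -/
theorem proj_mem_of_mem [CharZero K]
    (hLND : ∀ D : Derivation K A A, IsLocallyNilpotent D → D = 0)
    {t : Set A} (ht : t.Finite) (hdet : ∀ D : Derivation K A A, (∀ x ∈ t, D x = 0) → D = 0)
    {k : ℤ} {g : A} (hg : g ∈ ℬ k) (i : ℤ) : proj 𝒜 i g ∈ ℬ k := by
  apply mem_of_euler_eq ℬ
  obtain ⟨s, hs, hsum⟩ := exists_finset_proj 𝒜 g
  have h1 : proj 𝒜 i (euler ℬ g) = euler ℬ (proj 𝒜 i g) := by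
    conv_lhs => rw [← hsum, map_sum, map_sum]
    have hst : ∀ j, euler ℬ (proj 𝒜 j g) ∈ 𝒜 j := fun j =>
      euler_mem_of_mem 𝒜 ℬ hLND ht hdet (proj_mem 𝒜 j g)
    rw [Finset.sum_eq_single i (fun j _ hj => proj_of_mem_ne 𝒜 (hst j) hj), proj_of_mem 𝒜 (hst i)]
    intro hi
    rw [show proj 𝒜 i g = 0 from not_not.1 fun h0 => hi (hs i h0), map_zero, map_zero]
  rw [← h1, euler_of_mem ℬ hg, map_smul]

end Gradings

/-! ### Regular functions on the punctured line. -/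

section PuncturedLine

open Polynomial

variable {K : Type*} [Field K]

/-- The punctured line `Kˣ` as a subset of the line. -/
def unitCoord (K : Type*) [Field K] : Kˣ → Unit → K :=
  fun z _ => z

theorem eq_of_forall_units [Infinite K] {p q : K[X]}
    (h : ∀ z : Kˣ, p.eval (z : K) = q.eval (z : K)) :
    p = q := by
  have h1 : X * p = X * q := funext fun z => by
    by_cases hz : z = 0
    · simp [hz]
    · simpa [hz] using h (Units.mk0 z hz)
  exact mul_left_cancel₀ X_ne_zero h1

theorem eq_C_mul_X_pow [IsAlgClosed K] {q : K[X]} (hq : ∀ z : Kˣ, q.eval (z : K) ≠ 0) :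
    q = C q.leadingCoeff * X ^ q.natDegree := by
  have h1 : q.roots = Multiset.replicate q.natDegree 0 := by
    rw [Multiset.eq_replicate]
    refine ⟨(IsAlgClosed.splits q).natDegree_eq_card_roots.symm, fun z hz => ?_⟩
    by_contra h0
    exact hq (Units.mk0 z h0) (isRoot_of_mem_roots hz)
  conv_lhs => rw [(IsAlgClosed.splits q).eq_prod_roots, h1]
  simp

/-- A regular function on the punctured line is a Laurent polynomial, with degrees bounded in terms
of any presentation as a quotient. -/
theorem exists_laurent [IsAlgClosed K] {G : Kˣ → K}
    (hG : ∀ z₀ : Kˣ, ∃ p q : K[X], q.eval (z₀ : K) ≠ 0 ∧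
      ∀ z : Kˣ, q.eval (z : K) ≠ 0 → G z = p.eval (z : K) / q.eval (z : K))
    {p q : K[X]} {N : ℕ} (hp : p.natDegree ≤ N) (hqN : q.natDegree ≤ N) (hq : q ≠ 0)
    (hpq : ∀ z : Kˣ, q.eval (z : K) ≠ 0 → G z = p.eval (z : K) / q.eval (z : K)) :
    ∃ g : K[X], g.natDegree ≤ 2 * N ∧ ∀ z : Kˣ, (z : K) ^ N * G z = g.eval (z : K) := by
  classical
  have : Infinite K := IsAlgClosed.instInfinite
  obtain ⟨d, p₁, q₁, hcop, hp₁, hq₁⟩ : ∃ d p₁ q₁ : K[X], IsCoprime p₁ q₁ ∧ p = d * p₁ ∧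
      q = d * q₁ := by
    obtain ⟨p₁, hp₁⟩ := EuclideanDomain.gcd_dvd_left p q
    obtain ⟨q₁, hq₁⟩ := EuclideanDomain.gcd_dvd_right p q
    refine ⟨_, p₁, q₁, ⟨EuclideanDomain.gcdA p q, EuclideanDomain.gcdB p q, ?_⟩, hp₁, hq₁⟩
    refine mul_left_cancel₀ (fun h => hq (EuclideanDomain.gcd_eq_zero_iff.1 h).2 :
      EuclideanDomain.gcd p q ≠ 0) ?_
    have h := EuclideanDomain.gcd_eq_gcd_ab p q
    linear_combination -EuclideanDomain.gcdA p q * hp₁ - EuclideanDomain.gcdB p q * hq₁ - h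
  have hd : d ≠ 0 := fun h => hq (by rw [hq₁, h, zero_mul])
  have hq₁0 : q₁ ≠ 0 := fun h => hq (by rw [hq₁, h, mul_zero])
  -- If the reduced denominator vanished at `z`, comparison with a presentation valid at `z` would
  -- make the numerator vanish there too, against coprimality. So `q₁` has no nonzero roots and is a
  -- monomial.
  have hloc : ∀ z : Kˣ, q₁.eval (z : K) ≠ 0 ∧ G z = p₁.eval (z : K) / q₁.eval (z : K) := by
    intro z
    obtain ⟨p', q', hq', h'⟩ := hG z
    have hq'0 : q' ≠ 0 := fun h => hq' (by rw [h, eval_zero])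
    have h1 : (q * q') * (p * q') = (q * q') * (p' * q) := by
      refine eq_of_forall_units fun w => ?_
      simp only [eval_mul]
      by_cases hw : q.eval (w : K) = 0
      · simp [hw]
      by_cases hw' : q'.eval (w : K) = 0
      · simp [hw']
      have h2 := hpq w hw
      rw [h' w hw', div_eq_div_iff hw' hw] at h2
      linear_combination -(eval (w : K) q * eval (w : K) q') * h2
    have h2 : p₁ * q' = p' * q₁ := by
      have h3 := mul_left_cancel₀ (mul_ne_zero hq hq'0) h1
      rw [hp₁, hq₁] at h3
      exact mul_left_cancel₀ hd (by linear_combination h3)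
    have h3 := congrArg (eval (z : K)) h2
    simp only [eval_mul] at h3
    have h4 : q₁.eval (z : K) ≠ 0 := by
      intro h0
      rw [h0, mul_zero] at h3
      obtain ⟨a, b, hab⟩ := hcop
      have := congrArg (eval (z : K)) hab
      simp [h0, (mul_eq_zero.1 h3).resolve_right hq'] at this
    exact ⟨h4, by rw [h' z hq', div_eq_div_iff hq' h4, h3]⟩
  have hmono := eq_C_mul_X_pow fun z => (hloc z).1
  set c := q₁.leadingCoeff
  set k := q₁.natDegree
  have hc : c ≠ 0 := leadingCoeff_ne_zero.2 hq₁0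
  have hp₁N : p₁.natDegree ≤ N := by
    by_cases h0 : p₁ = 0
    · simp [h0]
    rw [hp₁, natDegree_mul hd h0] at hp
    omega
  have hkN : k ≤ N := by
    rw [hq₁, natDegree_mul hd hq₁0] at hqN
    omega
  refine ⟨C c⁻¹ * X ^ (N - k) * p₁, ?_, fun z => ?_⟩
  · refine natDegree_mul_le.trans ?_
    have := natDegree_C_mul_X_pow_le c⁻¹ (N - k)
    omega
  · rw [(hloc z).2, hmono]
    simp only [eval_mul, eval_C, eval_pow, eval_X]
    have hz : (z : K) ≠ 0 := z.ne_zero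
    have hN : (z : K) ^ N = (z : K) ^ (N - k) * (z : K) ^ k := by
      rw [← pow_add, Nat.sub_add_cancel hkN]
    rw [hN]
    field_simp

theorem eq_of_sum_eq [Infinite K] {M : ℕ} {a b : ℕ → K}
    (h : ∀ z : Kˣ, ∑ i ∈ Finset.range M, (z : K) ^ i * a i =
      ∑ i ∈ Finset.range M, (z : K) ^ i * b i) {i : ℕ} (hi : i < M) : a i = b i := by
  have h1 : ∑ i ∈ Finset.range M, C (a i) * X ^ i = ∑ i ∈ Finset.range M, C (b i) * X ^ i :=
    eq_of_forall_units fun z => by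
      rw [eval_finsetSum, eval_finsetSum]
      refine (Finset.sum_congr rfl fun i _ => ?_).trans
        ((h z).trans (Finset.sum_congr rfl fun i _ => ?_)) <;>
      rw [eval_mul, eval_C, eval_pow, eval_X, mul_comm]
  have h2 := congrArg (fun p => coeff p i) h1
  simpa [finsetSum_coeff, coeff_C_mul, coeff_X_pow, hi] using h2

end PuncturedLine

/-! ### Laurent expansion of regular functions on the product of the punctured line and `X`. -/

section Product

open Polynomial

variable {K : Type*} [Field K] {n : ℕ} {X : Set (Fin n → K)}

theorem isRegularMap_mk {G κ : Type*} (c : G → κ → K) (g : G) :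
    IsRegularMap (Subtype.val : X → Fin n → K) (prodCoord c Subtype.val) fun x => (g, x)
  | Sum.inl i => by
    simpa [prodCoord] using IsRegularFun.of_polynomial Subtype.val (MvPolynomial.C (c g i))
  | Sum.inr j => isRegularFun_coord _ j

/-- The specialization of a polynomial on `K × K^n` at a point of `K^n`. -/
noncomputable def specialize (x : Fin n → K) : MvPolynomial (Unit ⊕ Fin n) K →ₐ[K] K[X] :=
  MvPolynomial.aeval (Sum.elim (fun _ => Polynomial.X) fun j => C (x j))

theorem eval_specialize (x : X) (z : Kˣ) (p : MvPolynomial (Unit ⊕ Fin n) K) :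
    (specialize x.1 p).eval (z : K) =
      MvPolynomial.eval (prodCoord (unitCoord K) Subtype.val (z, x)) p := by
  have : (Polynomial.aeval (z : K)).comp (specialize x.1) =
      MvPolynomial.aeval (prodCoord (unitCoord K) Subtype.val (z, x)) := by
    ext (i | j) <;> simp [specialize, prodCoord, unitCoord]
  simpa [MvPolynomial.coe_aeval_eq_eval, Polynomial.coe_aeval_eq_eval] using
    DFunLike.congr_fun this p

theorem natDegree_specialize_le (x : Fin n → K) (p : MvPolynomial (Unit ⊕ Fin n) K) :
    (specialize x p).natDegree ≤ p.totalDegree := by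
  have := MvPolynomial.aeval_natDegree_le (n := 1) p le_rfl
    (Sum.elim (fun _ => Polynomial.X) fun j => C (x j)) (by rintro (i | j) <;> simp)
  rwa [mul_one] at this

/-- The regular functions on `Kˣ × X` are Laurent polynomials in the first variable. -/
theorem exists_laurent_product [IsAlgClosed K] [CharZero K] (hX : IsIrredQuasiAffine X)
    {F : Kˣ × X → K} (hF : IsRegularFun (prodCoord (unitCoord K) Subtype.val) F) :
    ∃ (N : ℕ) (c : ℕ → RegularAlgebra X), ∀ (z : Kˣ) (x : X),
      (z : K) ^ N * F (z, x) = ∑ i ∈ Finset.range (2 * N + 1), (z : K) ^ i * evalAt x (c i) := by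
  classical
  have := hX.isDomain
  have hFz : ∀ z, IsRegularFun (Subtype.val : X → Fin n → K) fun x => F (z, x) := fun z =>
    hF.comp (isRegularMap_mk _ z)
  obtain ⟨x₀⟩ := hX.nonempty
  -- A single presentation bounds the Laurent degrees uniformly over the open set of `x` where `Q(1,
  -- x) ≠ 0`.
  obtain ⟨P, Q, hQ, hPQ⟩ := hF (1, x₀)
  set N := max P.totalDegree Q.totalDegree
  let v : ℕ → Kˣ := fun i => Units.mk0 ((i + 1 : ℕ) : K) (by exact_mod_cast Nat.succ_ne_zero i)
  have hv : Set.InjOn (fun i => (v i : K)) (Finset.range (2 * N + 1)) := fun i _ j _ hij => by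
    have : ((i + 1 : ℕ) : K) = ((j + 1 : ℕ) : K) := hij
    exact Nat.succ_injective (Nat.cast_injective this)
  set b := Lagrange.basis (Finset.range (2 * N + 1)) fun i => (v i : K)
  have hbdeg : ∀ i ∈ Finset.range (2 * N + 1), (b i).natDegree < 2 * N + 1 := by
    intro i hi
    rw [Nat.lt_succ_iff, natDegree_le_iff_degree_le, Lagrange.degree_basis hv hi]
    simp
  -- Interpolating `z ^ N * F` at `2 * N + 1` distinct nonzero nodes writes the coefficients as
  -- combinations of the functions `F (v i, ·)`, hence as regular functions on all of `X`.
  let c : ℕ → RegularAlgebra X := fun k => ∑ i ∈ Finset.range (2 * N + 1),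
    ((v i : K) ^ N * (b i).coeff k) • ⟨fun x => F (v i, x), hFz (v i)⟩
  have hsum : ∀ (z : Kˣ) (x : X),
      ∑ i ∈ Finset.range (2 * N + 1), (z : K) ^ i * evalAt x (c i) =
        ∑ i ∈ Finset.range (2 * N + 1), (v i : K) ^ N * F (v i, x) * (b i).eval (z : K) := by
    intro z x
    simp only [c, map_sum, map_smul, smul_eq_mul, Finset.mul_sum, evalAt_apply]
    rw [Finset.sum_comm]
    refine Finset.sum_congr rfl fun i hi => ?_
    rw [eval_eq_sum_range' (hbdeg i hi), Finset.mul_sum]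
    refine Finset.sum_congr rfl fun k _ => ?_
    ring
  refine ⟨N, c, fun z => ?_⟩
  set Q₁ : MvPolynomial (Fin n) K :=
    MvPolynomial.aeval (Sum.elim (fun _ => 1) fun j => MvPolynomial.X j) Q
  have hQ₁ : ∀ x : X, evalAt x (restrict X Q₁) =
      MvPolynomial.eval (prodCoord (unitCoord K) Subtype.val (1, x)) Q := by
    intro x
    have : ((evalAt x).comp (restrict X)).comp
        (MvPolynomial.aeval (Sum.elim (fun _ => 1) fun j => MvPolynomial.X j)) =
        MvPolynomial.aeval (prodCoord (unitCoord K) Subtype.val (1, x)) := by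
      ext (i | j) <;> simp [evalAt_restrict, prodCoord, unitCoord]
    exact (DFunLike.congr_fun this Q).trans (by rw [MvPolynomial.aeval_eq_eval])
  have hQ₁0 : restrict X Q₁ ≠ 0 := fun h => hQ (by rw [← hQ₁, h, map_zero])
  have hU : ∀ x : X, evalAt x (restrict X Q₁) ≠ 0 →
      (z : K) ^ N * F (z, x) =
        ∑ i ∈ Finset.range (2 * N + 1), (z : K) ^ i * evalAt x (c i) := by
    intro x hx
    rw [hQ₁, ← eval_specialize] at hx
    obtain ⟨g, hg, hgF⟩ := exists_laurent (G := fun z => F (z, x)) (p := specialize x.1 P)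
      (q := specialize x.1 Q) (N := N) (fun z₀ => by
        obtain ⟨p, q, hq, h⟩ := hF (z₀, x)
        exact ⟨specialize x.1 p, specialize x.1 q, by rwa [eval_specialize], fun z hz => by
          rw [eval_specialize] at hz
          rw [h _ hz, eval_specialize, eval_specialize]⟩)
      ((natDegree_specialize_le _ _).trans (le_max_left _ _))
      ((natDegree_specialize_le _ _).trans (le_max_right _ _))
      (fun h => hx (by rw [h, eval_zero]))
      (fun z hz => by
        rw [eval_specialize] at hz
        rw [hPQ _ hz, eval_specialize, eval_specialize])
    have h1 := Lagrange.eq_interpolate_of_eval_eq (fun i => (v i : K) ^ N * F (v i, x)) hv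
      (f := g) (by
        rw [Finset.card_range]
        exact degree_le_natDegree.trans_lt (by exact_mod_cast Nat.lt_succ_of_le hg))
      fun i _ => (hgF (v i)).symm
    rw [hgF, h1, hsum, Lagrange.interpolate_apply, eval_finsetSum]
    exact Finset.sum_congr rfl fun i _ => by rw [eval_mul, eval_C]
  -- The expansion holds where `Q₁` is nonzero, so it holds everywhere because the regular functions
  -- form a domain.
  have hzero : restrict X Q₁ * ((z : K) ^ N • (⟨fun x => F (z, x), hFz z⟩ : RegularAlgebra X) -
      ∑ i ∈ Finset.range (2 * N + 1), (z : K) ^ i • c i) = 0 := by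
    refine regular_ext fun x => ?_
    rw [map_mul, map_zero]
    by_cases hx : evalAt x (restrict X Q₁) = 0
    · rw [hx, zero_mul]
    · simp only [map_sub, map_smul, map_sum, smul_eq_mul, ← hU x hx]
      change _ * ((z : K) ^ N * F (z, x) - (z : K) ^ N * F (z, x)) = 0
      rw [sub_self, mul_zero]
  intro x
  have h := congrArg (evalAt x) ((mul_eq_zero.1 hzero).resolve_left hQ₁0)
  simp only [map_sub, map_smul, map_sum, smul_eq_mul, map_zero, sub_eq_zero] at h
  exact h

end Product

/-! ### Linear independence of simultaneously diagonalizable derivations. -/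

section Derivations

variable {K A ι : Type*} [Field K] [CommRing A] [Algebra K A]

theorem derivation_sum_apply (t : Finset ι) (D : ι → Derivation K A A) (f : A) :
    (∑ i ∈ t, D i) f = ∑ i ∈ t, D i f := by
  classical
  induction t using Finset.induction_on with
  | empty => rfl
  | insert i t hi ih => rw [Finset.sum_insert hi, Finset.sum_insert hi, Derivation.add_apply, ih]

/-- A linear relation over `A` between derivations with enough joint eigenvectors specializes to
linear relations over `K`. -/
theorem sum_smul_derivation_eq_zero [IsDomain A] {t : Finset ι} {D : ι → Derivation K A A}
    (hspan : Submodule.span K {g | ∀ i ∈ t, ∃ w : K, D i g = w • g} = ⊤) {c : ι → A}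
    (hc : ∑ i ∈ t, c i • D i = 0) (φ : A →ₐ[K] K) : ∑ i ∈ t, φ (c i) • D i = 0 := by
  ext1 f
  have hf : f ∈ Submodule.span K {g | ∀ i ∈ t, ∃ w : K, D i g = w • g} := by
    rw [hspan]
    trivial
  induction hf using Submodule.span_induction with
  | zero => rw [map_zero, map_zero]
  | add f g _ _ hf hg => rw [map_add, map_add, hf, hg]
  | smul a f _ hf => rw [Derivation.map_smul, Derivation.map_smul, hf]
  | mem g hg =>
    by_cases hg0 : g = 0
    · rw [hg0, map_zero, map_zero]
    choose! w hw using hg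
    -- On a joint eigenvector the relation becomes scalar: cancel `g`, then apply `φ`.
    have h1 : (∑ i ∈ t, w i • c i) * g = 0 := by
      have h2 := DFunLike.congr_fun hc g
      rw [derivation_sum_apply, Derivation.zero_apply] at h2
      rw [← h2, Finset.sum_mul]
      refine Finset.sum_congr rfl fun i hi => ?_
      rw [Derivation.smul_apply, hw i hi, smul_mul_assoc, smul_eq_mul, mul_smul_comm]
    have h3 := congrArg φ ((mul_eq_zero.1 h1).resolve_right hg0)
    rw [map_sum, map_zero] at h3
    rw [derivation_sum_apply, Derivation.zero_apply]
    calc ∑ i ∈ t, (φ (c i) • D i) g = ∑ i ∈ t, φ (w i • c i) • g :=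
          Finset.sum_congr rfl fun i hi => by
            rw [Derivation.smul_apply, hw i hi, map_smul, smul_smul, smul_eq_mul, mul_comm]
      _ = 0 := by rw [← Finset.sum_smul, h3, zero_smul]

/-- A set of linearly independent derivations with enough joint eigenvectors is finite, if
derivations are determined by finitely many values. -/
theorem finite_of_linearIndependent_derivation [IsDomain A] {n : ℕ} {x : Fin n → A}
    (hdet : ∀ D : Derivation K A A, (∀ j, D (x j) = 0) → D = 0)
    (hpt : ∀ a : A, (∀ φ : A →ₐ[K] K, φ a = 0) → a = 0)
    {D : ι → Derivation K A A} (hli : LinearIndependent K D)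
    (hspan : ∀ t : Finset ι, Submodule.span K {g | ∀ i ∈ t, ∃ w : K, D i g = w • g} = ⊤) :
    Finite ι := by
  have h : LinearIndependent A fun i (j : Fin n) => D i (x j) := by
    rw [linearIndependent_iff']
    intro t c hc i hi
    have hD : ∑ i ∈ t, c i • D i = 0 := hdet _ fun j => by
      have h := congrFun hc j
      rw [Finset.sum_apply] at h
      rw [derivation_sum_apply]
      exact h
    exact hpt _ fun φ => linearIndependent_iff'.1 hli t (fun i => φ (c i))
      (sum_smul_derivation_eq_zero (hspan t) hD φ) i hi
  exact h.finite

end Derivations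

/-! ### One-parameter tori and their weight gradings. -/

section Cocharacters

variable {K : Type*} [Field K] {n : ℕ} {X : Set (Fin n → K)}

/-- The action of an automorphism on regular functions. -/
def pullback (φ : Aut X) : RegularAlgebra X →ₐ[K] RegularAlgebra X where
  toFun f := ⟨fun x => f.1 ((φ : Equiv.Perm X) x), f.2.comp φ.2.1⟩
  map_one' := rfl
  map_mul' _ _ := rfl
  map_zero' := rfl
  map_add' _ _ := rfl
  commutes' _ := rfl

variable (X) in
/-- A cocharacter of `Aut(X)`: a regular action on `X` of the one-dimensional torus. -/
def Cocharacter : Type _ :=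
  {χ : Kˣ →* Aut X // IsRegularAction (unitCoord K) χ}

/-- The regular functions on which a cocharacter acts with weight `i`. -/
def weight (χ : Cocharacter X) (i : ℤ) : Submodule K (RegularAlgebra X) where
  carrier := {f | ∀ (z : Kˣ) (x : X),
    evalAt ((χ.1 z : Equiv.Perm X) x) f = (z : K) ^ i * evalAt x f}
  zero_mem' z x := by simp only [map_zero, mul_zero]
  add_mem' hf hg z x := by simp only [map_add, hf z x, hg z x, mul_add]
  smul_mem' c f hf z x := by simp only [map_smul, hf z x, smul_eq_mul, mul_left_comm]

instance (χ : Cocharacter X) : SetLike.GradedMonoid (weight χ) where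
  one_mem z x := by simp
  mul_mem i j f g hf hg z x := by
    rw [map_mul, map_mul, hf z x, hg z x, zpow_add₀ z.ne_zero]
    ring

theorem zpow_two_injective [CharZero K] : Function.Injective fun i : ℤ => (2 : K) ^ i := by
  intro i j h
  have h1 : ((2 ^ i : ℚ) : K) = ((2 ^ j : ℚ) : K) := by
    push_cast
    exact h
  exact zpow_right_injective₀ (by norm_num) (by norm_num) (Rat.cast_injective h1)

/-- The single element `2` of the torus separates weights: it acts on weight `i` by `2 ^ i`, and
these are distinct in characteristic zero. -/
theorem iSupIndep_weight [CharZero K] (χ : Cocharacter X) : iSupIndep (weight χ) := by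
  have h2 : (2 : K) ≠ 0 := two_ne_zero
  refine ((Module.End.eigenspaces_iSupIndep
    (pullback (χ.1 (Units.mk0 2 h2))).toLinearMap).comp zpow_two_injective).mono fun i f hf => ?_
  rw [Function.comp_apply, Module.End.mem_eigenspace_iff]
  refine regular_ext fun x => ?_
  rw [map_smul]
  exact hf (Units.mk0 2 h2) x

variable [IsAlgClosed K] [CharZero K]

/-- The Laurent coefficients of `z ↦ f (z · x)` sum to `f` (put `z = 1`), and the one of index `i`
has weight `i - N`. -/
theorem iSup_weight_eq_top (hX : IsIrredQuasiAffine X) (χ : Cocharacter X) :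
    iSup (weight χ) = ⊤ := by
  rw [eq_top_iff]
  intro f _
  obtain ⟨N, c, hc⟩ := exists_laurent_product hX (f.2.comp χ.2)
  replace hc : ∀ (z : Kˣ) (x : X), (z : K) ^ N * evalAt ((χ.1 z : Equiv.Perm X) x) f =
    ∑ i ∈ Finset.range (2 * N + 1), (z : K) ^ i * evalAt x (c i) := hc
  have hf : f = ∑ i ∈ Finset.range (2 * N + 1), c i := regular_ext fun x => by
    have := hc 1 x
    simpa using this
  rw [hf]
  refine Submodule.sum_mem _ fun i hi => Submodule.mem_iSup_of_mem ((i : ℤ) - N) fun z x => ?_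
  have hz : (z : K) ≠ 0 := z.ne_zero
  -- Compare coefficients in `w` of the expansion at `w` over the point `z · x` with that at `w * z`
  -- over `x`.
  have key := eq_of_sum_eq (a := fun i => (z : K) ^ N * evalAt ((χ.1 z : Equiv.Perm X) x) (c i))
    (b := fun i => (z : K) ^ i * evalAt x (c i)) (fun w => by
      have h1 := hc w ((χ.1 z : Equiv.Perm X) x)
      have h2 := hc (w * z) x
      rw [map_mul, Subgroup.coe_mul, Equiv.Perm.mul_apply, Units.val_mul, mul_pow] at h2
      simp only [mul_left_comm _ ((z : K) ^ N)]
      rw [← Finset.mul_sum, ← h1, ← mul_assoc, mul_comm ((z : K) ^ N), h2]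
      exact Finset.sum_congr rfl fun i _ => by rw [mul_pow, mul_assoc]) (Finset.mem_range.1 hi)
  rw [zpow_sub₀ hz, zpow_natCast, zpow_natCast, div_mul_eq_mul_div, eq_div_iff (pow_ne_zero _ hz),
    mul_comm]
  exact key

/-- The grading of the algebra of regular functions given by a cocharacter. -/
noncomputable abbrev weightGrading (hX : IsIrredQuasiAffine X) (χ : Cocharacter X) :
    GradedAlgebra (weight χ) :=
  { toGradedMonoid := inferInstance
    toDecomposition := (DirectSum.isInternal_submodule_of_iSupIndep_of_iSup_eq_top
      (iSupIndep_weight χ) (iSup_weight_eq_top hX χ)).chooseDecomposition }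

/-- The derivation given by a cocharacter. -/
noncomputable def cocharDer (hX : IsIrredQuasiAffine X) (χ : Cocharacter X) :
    Derivation K (RegularAlgebra X) (RegularAlgebra X) :=
  letI := weightGrading hX χ
  euler (weight χ)

theorem mem_weight_iff (hX : IsIrredQuasiAffine X) (χ : Cocharacter X) {i : ℤ}
    {f : RegularAlgebra X} : f ∈ weight χ i ↔ cocharDer hX χ f = (i : K) • f :=
  let _ := weightGrading hX χ
  ⟨euler_of_mem (weight χ), mem_of_euler_eq (weight χ)⟩

theorem exists_mem_weight (hX : IsIrredQuasiAffine X) (χ : Cocharacter X) {c : K}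
    {f : RegularAlgebra X} (hf : cocharDer hX χ f = c • f) : ∃ i : ℤ, f ∈ weight χ i := by
  let _ := weightGrading hX χ
  by_cases hf0 : f = 0
  · exact ⟨0, by rw [hf0]; exact zero_mem _⟩
  obtain ⟨i, rfl⟩ := exists_int_of_euler_eq (weight χ) hf0 hf
  exact ⟨i, (mem_weight_iff hX χ).2 hf⟩

/-- On a rigid variety, the components of a weight vector of one cocharacter with respect to another
one are weight vectors of the same weight. -/
theorem exists_weight_decomposition (hX : IsIrredQuasiAffine X) (hr : IsRigid X)
    (χ : Cocharacter X) (f : RegularAlgebra X) :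
    ∃ (s : Finset ℤ) (g : ℤ → RegularAlgebra X), f = ∑ i ∈ s, g i ∧ (∀ i, g i ∈ weight χ i) ∧
      ∀ (χ' : Cocharacter X) (k : ℤ), f ∈ weight χ' k → ∀ i, g i ∈ weight χ' k := by
  let _ := weightGrading hX χ
  obtain ⟨s, -, hs⟩ := exists_finset_proj (weight χ) f
  refine ⟨s, fun i => GradedAlgebra.proj (weight χ) i f, hs.symm, fun i => proj_mem _ i f,
    fun χ' k hf i => ?_⟩
  let _ := weightGrading hX χ'
  exact proj_mem_of_mem (weight χ) (weight χ')
    (fun D hD => hr.eq_zero_of_isLocallyNilpotent hX hD) (Set.finite_range (coord X))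
    (fun D hD => hX.derivation_eq_zero D fun j => hD _ ⟨j, rfl⟩) hf i

/-- The regular functions which are weight vectors of each of the cocharacters in `C`. -/
def jointWeightVectors (C : Set (Cocharacter X)) : Set (RegularAlgebra X) :=
  {g | ∀ χ ∈ C, ∃ i, g ∈ weight χ i}

/-- Splitting a joint weight vector along one more cocharacter keeps its weights for the earlier
ones. -/
theorem span_jointWeightVectors (hX : IsIrredQuasiAffine X) (hr : IsRigid X)
    {C : Set (Cocharacter X)} (hC : C.Finite) :
    Submodule.span K (jointWeightVectors C) = ⊤ := by
  induction C, hC using Set.Finite.induction_on with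
  | empty => rw [show jointWeightVectors (∅ : Set (Cocharacter X)) = Set.univ from
      Set.eq_univ_of_forall fun g χ hχ => hχ.elim, Submodule.span_univ]
  | @insert χ C _ _ ih =>
    rw [eq_top_iff, ← ih, Submodule.span_le]
    intro f hf
    obtain ⟨s, g, hfg, hg, hg'⟩ := exists_weight_decomposition hX hr χ f
    rw [SetLike.mem_coe, hfg]
    refine Submodule.sum_mem _ fun i _ => Submodule.subset_span ?_
    rintro χ' (rfl | hχ')
    · exact ⟨i, hg i⟩
    · obtain ⟨k, hk⟩ := hf χ' hχ'
      exact ⟨k, hg' χ' k hk i⟩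

/-- On a rigid variety, the derivations given by the cocharacters span a finite dimensional
space. -/
theorem exists_finite_span_cocharDer (hX : IsIrredQuasiAffine X) (hr : IsRigid X) :
    ∃ C : Set (Cocharacter X), C.Finite ∧
      ∀ χ, cocharDer hX χ ∈ Submodule.span K (cocharDer hX '' C) := by
  have := hX.isDomain
  obtain ⟨b, hb, hspan, hli⟩ := exists_linearIndependent K (Set.range (cocharDer hX))
  choose χ hχ using fun D : b => hb D.2
  have hfin : Finite b := by
    refine finite_of_linearIndependent_derivation hX.derivation_eq_zero
      (fun a ha => regular_ext fun x => by rw [ha, map_zero]) hli fun t => ?_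
    rw [eq_top_iff, ← span_jointWeightVectors hX hr (t.finite_toSet.image χ)]
    refine Submodule.span_mono fun g hg D hD => ?_
    obtain ⟨i, hi⟩ := hg (χ D) ⟨D, hD, rfl⟩
    exact ⟨i, by rw [← hχ D]; exact (mem_weight_iff hX _).1 hi⟩
  refine ⟨Set.range χ, Set.finite_range χ, fun χ' => ?_⟩
  have h1 : cocharDer hX '' Set.range χ = b := by
    ext D
    constructor
    · rintro ⟨_, ⟨D, rfl⟩, rfl⟩
      rw [hχ]
      exact D.2
    · exact fun hD => ⟨_, ⟨⟨D, hD⟩, rfl⟩, hχ _⟩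
  rw [h1, hspan]
  exact Submodule.subset_span ⟨χ', rfl⟩

/-- On a rigid variety, there are finitely many nonzero regular functions which span all
coordinates and are weight vectors of all cocharacters. -/
theorem exists_weightVectors (hX : IsIrredQuasiAffine X) (hr : IsRigid X) :
    ∃ G : Finset (RegularAlgebra X), 0 ∉ G ∧
      (∀ j, coord X j ∈ Submodule.span K (G : Set (RegularAlgebra X))) ∧
      ∀ χ : Cocharacter X, ∀ g ∈ G, ∃ i, g ∈ weight χ i := by
  classical
  obtain ⟨C, hC, hspan⟩ := exists_finite_span_cocharDer hX hr
  have hcoord : ∀ j, coord X j ∈ Submodule.span K (jointWeightVectors C) := fun j => by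
    rw [span_jointWeightVectors hX hr hC]
    trivial
  choose T hT hcT using fun j => Submodule.mem_span_finite_of_mem_span (hcoord j)
  refine ⟨(Finset.univ.biUnion T).erase 0, Finset.notMem_erase _ _, fun j => ?_, fun χ g hg => ?_⟩
  · rw [Finset.coe_erase, Submodule.span_sdiff_singleton_zero]
    exact Submodule.span_mono (Finset.coe_subset.2
      (Finset.subset_biUnion_of_mem T (Finset.mem_univ j))) (hcT j)
  · obtain ⟨j, -, hj⟩ := Finset.mem_biUnion.1 (Finset.mem_of_mem_erase hg)
    have hg := hT j hj
    -- A joint eigenvector for `C` is an eigenvector of every combination, hence of every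
    -- `cocharDer`; the eigenvalue is then automatically an integer.
    have key : ∀ D ∈ Submodule.span K (cocharDer hX '' C), ∃ c : K, D g = c • g := by
      intro D hD
      induction hD using Submodule.span_induction with
      | zero => exact ⟨0, by rw [Derivation.zero_apply, zero_smul]⟩
      | add D E _ _ hD hE =>
        obtain ⟨c, hc⟩ := hD
        obtain ⟨d, hd⟩ := hE
        exact ⟨c + d, by rw [Derivation.add_apply, hc, hd, add_smul]⟩
      | smul a D _ hD =>
        obtain ⟨c, hc⟩ := hD
        exact ⟨a * c, by rw [Derivation.smul_apply, hc, smul_smul]⟩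
      | mem D hD =>
        obtain ⟨χ', hχ', rfl⟩ := hD
        obtain ⟨i, hi⟩ := hg χ' hχ'
        exact ⟨i, (mem_weight_iff hX _).1 hi⟩
    obtain ⟨c, hc⟩ := key _ (hspan χ)
    exact exists_mem_weight hX χ hc

end Cocharacters

/-! ### Monomial maps of tori and lattices of exponents. -/

section Torus

variable {K : Type*} [Field K]

theorem IsRegularFun.zpow {P ι : Type*} {e : P → ι → K} {f : P → K} (hf : IsRegularFun e f)
    (h0 : ∀ x, f x ≠ 0) (k : ℤ) : IsRegularFun e fun x => f x ^ k := by
  obtain ⟨k, rfl | rfl⟩ := k.eq_nat_or_neg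
  · simp only [zpow_natCast]
    exact (regularSubalgebra e).pow_mem hf k
  · simp only [zpow_neg, zpow_natCast, ← inv_pow]
    exact (regularSubalgebra e).pow_mem (hf.inv h0) k

theorem prod_zpow_eq {M ι : Type*} [CommGroup M] (z : M) (t : Finset ι) (c : ι → ℤ) :
    ∏ i ∈ t, z ^ c i = z ^ ∑ i ∈ t, c i := by
  classical
  induction t using Finset.induction_on with
  | empty => simp
  | insert i t hi ih => rw [Finset.prod_insert hi, Finset.sum_insert hi, zpow_add, ih]

/-- The monomial map between tori with exponents `b`. -/
def monomialMap (K : Type*) [Field K] {ι κ : Type*} [Fintype κ] (b : κ → ι → ℤ) :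
    (κ → Kˣ) →* (ι → Kˣ) where
  toFun s i := ∏ k, s k ^ b k i
  map_one' := by ext; simp
  map_mul' s t := by
    ext i
    simp [mul_zpow, Finset.prod_mul_distrib]

theorem isRegularFun_monomialMap {ι : Type*} {r : ℕ} (b : Fin r → ι → ℤ) (i : ι) :
    IsRegularFun (torusCoord K r) fun s => (monomialMap K b s i : K) := by
  have h := (regularSubalgebra (torusCoord K r)).prod_mem (t := Finset.univ) fun k _ =>
    (isRegularFun_coord (torusCoord K r) k).zpow (fun s => (s k).ne_zero) (b k i)
  rw [mem_regularSubalgebra] at h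
  convert h using 1
  funext s
  rw [Finset.prod_apply]
  simp [monomialMap, torusCoord, Units.coe_prod]

/-- A monomial map whose exponents are part of a basis of the lattice is injective. -/
theorem monomialMap_injective {ι κ : Type*} [Fintype ι] [Fintype κ]
    (b : Module.Basis ι ℤ (ι → ℤ)) (f : κ ↪ ι) :
    Function.Injective (monomialMap K fun k => b (f k)) := by
  classical
  rw [injective_iff_map_eq_one]
  intro s hs
  funext k₀
  -- The dual basis vector of `b (f k₀)` in standard coordinates; the monomial with these exponents
  -- recovers `s k₀`.
  let y : ι → ℤ := fun i => b.coord (f k₀) (Pi.single i 1)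
  have hy : ∀ k, ∑ i, b (f k) i * y i = if k = k₀ then 1 else 0 := by
    intro k
    have h1 : b (f k) = ∑ i, b (f k) i • Pi.single i (1 : ℤ) := by
      funext j
      simp [Finset.sum_apply, Pi.single_apply]
    have h2 := congrArg (b.coord (f k₀)) h1
    rw [map_sum] at h2
    simp only [map_smul, smul_eq_mul] at h2
    rw [← h2, Module.Basis.coord_apply, Module.Basis.repr_self, Finsupp.single_apply]
    simp [f.injective.eq_iff]
  have h : ∏ i, monomialMap K (fun k => b (f k)) s i ^ y i = s k₀ := by
    simp only [monomialMap, MonoidHom.coe_mk, OneHom.coe_mk, ← Finset.prod_zpow, ← zpow_mul]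
    rw [Finset.prod_comm]
    have : ∀ k, ∏ i, s k ^ (b (f k) i * y i) = if k = k₀ then s k else 1 := by
      intro k
      rw [prod_zpow_eq, hy]
      split_ifs <;> simp
    simp [this]
  rw [← h, hs]
  simp

theorem exists_zpow_eq [IsAlgClosed K] {a : ℤ} (ha : a ≠ 0) (s : Kˣ) : ∃ t : Kˣ, t ^ a = s := by
  have key : ∀ k : ℕ, 0 < k → ∃ t : Kˣ, t ^ k = s := by
    intro k hk
    obtain ⟨z, hz⟩ := IsAlgClosed.exists_pow_nat_eq (s : K) hk
    have hz0 : z ≠ 0 := by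
      rintro rfl
      rw [zero_pow hk.ne'] at hz
      exact s.ne_zero hz.symm
    exact ⟨Units.mk0 z hz0, Units.ext (by simpa using hz)⟩
  obtain ⟨k, rfl | rfl⟩ := a.eq_nat_or_neg
  · obtain ⟨t, ht⟩ := key k (by omega)
    exact ⟨t, by rw [zpow_natCast, ht]⟩
  · obtain ⟨t, ht⟩ := key k (by omega)
    exact ⟨t⁻¹, by rw [zpow_neg, zpow_natCast, inv_pow, inv_inv, ht]⟩

/-- The subgroup generated by one-parameter subgroups with exponents in a lattice `L` is contained
in the isomorphic image under a monomial map of a torus. -/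
theorem exists_monomialMap [IsAlgClosed K] {ι : Type*} [Fintype ι] (L : Submodule ℤ (ι → ℤ)) :
    ∃ (r : ℕ) (b : Fin r → ι → ℤ), Function.Injective (monomialMap K b) ∧
      (∀ d ∈ L, ∀ z : Kˣ, ∃ s, monomialMap K b s = fun i => z ^ d i) ∧
      ∀ H : Subgroup (ι → Kˣ), (∀ d ∈ L, ∀ z : Kˣ, (fun i => z ^ d i) ∈ H) →
        ∀ s, monomialMap K b s ∈ H := by
  classical
  -- The vectors `bM (f k)` span the saturation of `L`, while `L` itself is spanned by their
  -- multiples by `a k`.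
  obtain ⟨r, bM, bN, f, a, snf⟩ := Submodule.smithNormalForm (Pi.basisFun ℤ ι) L
  have ha : ∀ k, a k ≠ 0 := fun k h0 => bN.ne_zero k (Subtype.ext (by rw [snf, h0, zero_smul]; rfl))
  refine ⟨r, fun k => bM (f k), monomialMap_injective bM f, fun d hd z => ?_, fun H hH s => ?_⟩
  · refine ⟨fun k => z ^ (bN.repr ⟨d, hd⟩ k * a k), funext fun i => ?_⟩
    have h1 : d i = ∑ k, bN.repr ⟨d, hd⟩ k * a k * bM (f k) i := by
      have h2 := congrArg (fun v : L => (v : ι → ℤ) i) (bN.sum_repr ⟨d, hd⟩)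
      simp only [Submodule.coe_sum, Submodule.coe_smul, snf, Finset.sum_apply, Pi.smul_apply,
        smul_eq_mul] at h2
      rw [← h2]
      simp only [mul_assoc]
    simp only [monomialMap, MonoidHom.coe_mk, OneHom.coe_mk, ← zpow_mul]
    rw [prod_zpow_eq, h1]
  · have h1 : monomialMap K (fun k => bM (f k)) s = ∏ k, fun i => s k ^ bM (f k) i := by
      funext i
      rw [Finset.prod_apply]
      rfl
    rw [h1]
    refine H.prod_mem fun k _ => ?_
    -- Divisibility of `Kˣ` makes up for the index of `L` in its saturation.
    obtain ⟨t, ht⟩ := exists_zpow_eq (ha k) (s k)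
    have h2 : (fun i => s k ^ bM (f k) i) = fun i => t ^ (bN k : ι → ℤ) i := by
      funext i
      rw [← ht, ← zpow_mul, snf]
      rfl
    rw [h2]
    exact hH _ (bN k).2 t

end Torus

/-! ### Automorphisms scaling a finite set of functions, and the largest subtorus. -/

section Actions

variable {K : Type*} [Field K] {n : ℕ} {X : Set (Fin n → K)}

theorem IsRegularAction.comp {G H κ τ : Type*} [Group G] [Group H] {c : G → κ → K} {c' : H → τ → K}
    {ρ : G →* Aut X} (hρ : IsRegularAction c ρ) {θ : H →* G} (hθ : IsRegularMap c' c θ) :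
    IsRegularAction c' (ρ.comp θ) :=
  IsRegularMap.comp (φ := fun z : H × X => (θ z.1, z.2)) hρ
    ((hθ.comp (isRegularMap_fst c' Subtype.val)).prodMk (isRegularMap_snd _ _))

theorem isRegularMap_mulSingle {m : ℕ} (i : Fin m) :
    IsRegularMap (unitCoord K) (torusCoord K m) (MonoidHom.mulSingle (fun _ => Kˣ) i) := by
  intro j
  by_cases h : j = i
  · subst h
    simpa [torusCoord] using! isRegularFun_coord (unitCoord K) ()
  · simpa [torusCoord, h] using IsRegularFun.of_polynomial (unitCoord K) 1

variable {G : Finset (RegularAlgebra X)}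

theorem evalAt_eq_of_span (hG : ∀ j, coord X j ∈ Submodule.span K (G : Set (RegularAlgebra X)))
    {x y : X} (h : ∀ g ∈ G, evalAt x g = evalAt y g) : x = y := by
  refine Subtype.ext (funext fun j => ?_)
  rw [← evalAt_coord, ← evalAt_coord]
  exact LinearMap.eqOn_span (f := (evalAt x).toLinearMap) (g := (evalAt y).toLinearMap) h (hG j)

/-- A function in `G` pulls back along the action to its weight times itself, which is regular; the
coordinates are combinations of such functions. -/
theorem isRegularAction_of_weights
    (hG : ∀ j, coord X j ∈ Submodule.span K (G : Set (RegularAlgebra X)))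
    {H κ : Type*} [Group H] {c : H → κ → K} {ρ : H →* Aut X} {w : RegularAlgebra X → H → K}
    (hw : ∀ g ∈ G, IsRegularFun c (w g))
    (hρ : ∀ g ∈ G, ∀ t x, evalAt ((ρ t : Equiv.Perm X) x) g = w g t * evalAt x g) :
    IsRegularAction c ρ := by
  have key : ∀ f ∈ Submodule.span K (G : Set (RegularAlgebra X)),
      (fun z : H × X => evalAt ((ρ z.1 : Equiv.Perm X) z.2) f) ∈
        regularSubalgebra (prodCoord c (Subtype.val : X → Fin n → K)) := by
    intro f hf
    induction hf using Submodule.span_induction with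
    | zero =>
      simp only [map_zero]
      exact zero_mem _
    | add f g _ _ hf hg =>
      simp only [map_add]
      exact add_mem hf hg
    | smul a f _ hf =>
      simp only [map_smul]
      exact (regularSubalgebra (prodCoord c Subtype.val)).smul_mem hf a
    | mem g hg =>
      simp only [hρ g hg]
      exact ((hw g hg).comp (isRegularMap_fst _ _)).mul (g.2.comp (isRegularMap_snd _ _))
  intro j
  have h := key _ (hG j)
  simp only [evalAt_coord] at h
  exact h

variable (G) in
/-- The tuples of factors by which automorphisms of `X` scale the functions in `G`. -/
def scalings : Subgroup (G → Kˣ) where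
  carrier := {u | ∃ φ : Aut X, ∀ (g : G) (x : X),
    evalAt ((φ : Equiv.Perm X) x) g.1 = (u g : K) * evalAt x g.1}
  one_mem' := ⟨1, fun g x => by simp⟩
  mul_mem' := by
    rintro u v ⟨φ, hφ⟩ ⟨ψ, hψ⟩
    refine ⟨φ * ψ, fun g x => ?_⟩
    rw [Subgroup.coe_mul, Equiv.Perm.mul_apply, hφ, hψ, Pi.mul_apply, Units.val_mul, mul_assoc]
  inv_mem' := by
    rintro u ⟨φ, hφ⟩
    refine ⟨φ⁻¹, fun g x => ?_⟩
    have h : evalAt x g.1 = _ := (congrArg (fun y => evalAt y g.1)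
      (φ.1.apply_symm_apply x)).symm.trans (hφ g (φ.1.symm x))
    rw [h, Pi.inv_apply, Units.val_inv_eq_inv_val, inv_mul_cancel_left₀ (u g).ne_zero]
    rfl

/-- If the functions in `G` span the coordinates, then an automorphism is determined by the factors
by which it scales them. -/
theorem exists_scalings_hom
    (hG : ∀ j, coord X j ∈ Submodule.span K (G : Set (RegularAlgebra X))) :
    ∃ e : scalings G →* Aut X, ∀ (u : scalings G) (g : G) (x : X),
      evalAt ((e u : Equiv.Perm X) x) g.1 = (u.1 g : K) * evalAt x g.1 := by
  choose e he using fun u : scalings G => u.2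
  refine ⟨MonoidHom.mk' e fun u v => Subtype.ext (Equiv.ext fun x => ?_), he⟩
  refine evalAt_eq_of_span hG fun g hg => ?_
  change _ = evalAt ((e u : Equiv.Perm X) ((e v : Equiv.Perm X) x)) g
  rw [he (u * v) ⟨g, hg⟩, he u ⟨g, hg⟩, he v ⟨g, hg⟩, ← mul_assoc]
  rfl

variable [IsAlgClosed K] [CharZero K]

/-- On a rigid variety there is a subtorus of `Aut(X)` which contains the images of all regular
torus actions. -/
theorem exists_largest_subtorus (hX : IsIrredQuasiAffine X) (hr : IsRigid X) :
    ∃ 𝕋 : Subgroup (Aut X), IsSubtorus 𝕋 ∧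
      ∀ (m : ℕ) (ρ : (Fin m → Kˣ) →* Aut X), IsRegularAction (torusCoord K m) ρ →
        ρ.range ≤ 𝕋 := by
  obtain ⟨G, h0, hG, hwt⟩ := exists_weightVectors hX hr
  obtain ⟨e, he⟩ := exists_scalings_hom hG
  have huniq : ∀ (φ : Aut X) (u : scalings G), (∀ (g : G) (x : X),
      evalAt ((φ : Equiv.Perm X) x) g.1 = (u.1 g : K) * evalAt x g.1) → φ = e u :=
    fun φ u h => Subtype.ext (Equiv.ext fun x => evalAt_eq_of_span hG fun g hg => by
      rw [h ⟨g, hg⟩, he u ⟨g, hg⟩])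
  -- The functions in `G` are nonzero, so an automorphism determines its scaling factors.
  have hinj : Function.Injective e := fun u v huv => Subtype.ext (funext fun g => by
    obtain ⟨x, hx⟩ : ∃ x, evalAt x g.1 ≠ 0 := by
      by_contra! h
      exact h0 (by rw [← regular_ext (f := g.1) (g := 0) fun x => by rw [h, map_zero]]; exact g.2)
    have h := he u g x
    rw [huv, he v g x] at h
    exact Units.ext (mul_right_cancel₀ hx h.symm))
  -- Exponents of the diagonal one-parameter subgroups realized by automorphisms; no regularity need
  -- be imposed, since characters are regular.
  let L : Submodule ℤ (G → ℤ) := AddSubgroup.toIntSubmodule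
    { carrier := {d | ∀ z : Kˣ, (fun g => z ^ d g) ∈ scalings G}
      zero_mem' := fun z => by
        simp only [Pi.zero_apply, zpow_zero]
        exact one_mem (scalings G)
      add_mem' := fun {c d} hc hd z => by
        simp only [Pi.add_apply, zpow_add]
        exact mul_mem (hc z) (hd z)
      neg_mem' := fun {d} hd z => by
        simp only [Pi.neg_apply, zpow_neg]
        exact inv_mem (hd z) }
  have hL : ∀ d, d ∈ L ↔ ∀ z : Kˣ, (fun g => z ^ d g) ∈ scalings G := fun d => Iff.rfl
  obtain ⟨r, b, hb, hbL, hbH⟩ := exists_monomialMap (K := K) L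
  let θ : (Fin r → Kˣ) →* scalings G :=
    (monomialMap K b).codRestrict (scalings G) (hbH _ fun d hd z => (hL d).1 hd z)
  refine ⟨(e.comp θ).range, ⟨r, e.comp θ, ?_, ?_, rfl⟩, fun m ρ hρ => ?_⟩
  · classical
    refine isRegularAction_of_weights hG
      (w := fun g t => if hg : g ∈ G then (monomialMap K b t ⟨g, hg⟩ : K) else 0)
      (fun g hg => ?_) fun g hg t x => ?_
    · simpa only [hg, dite_true] using isRegularFun_monomialMap b ⟨g, hg⟩
    · simp only [hg, dite_true]
      exact he (θ t) ⟨g, hg⟩ x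
  · exact hinj.comp fun s t hst => hb (congrArg Subtype.val hst)
  · rintro _ ⟨t, rfl⟩
    change t ∈ ((e.comp θ).range).comap ρ
    -- A torus is generated by its coordinate one-parameter subgroups, and each acts as a
    -- cocharacter, whose weights on `G` form a vector in `L`.
    refine Subgroup.pi_mem_of_mulSingle_mem t fun i => ?_
    let χ : Cocharacter X := ⟨ρ.comp (MonoidHom.mulSingle (fun _ => Kˣ) i),
      hρ.comp (isRegularMap_mulSingle i)⟩
    choose d hd using fun g : G => hwt χ g.1 g.2
    have hχ : ∀ (z : Kˣ) (g : G) (x : X), evalAt ((χ.1 z : Equiv.Perm X) x) g.1 =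
        ((z ^ d g : Kˣ) : K) * evalAt x g.1 := fun z g x => by
      rw [Units.val_zpow_eq_zpow_val]
      exact hd g z x
    obtain ⟨s, hs⟩ := hbL d ((hL d).2 fun z => ⟨χ.1 z, hχ z⟩) (t i)
    refine ⟨s, (huniq (χ.1 (t i)) (θ s) fun g x => ?_).symm⟩
    rw [hχ]
    change _ = ((monomialMap K b s g : Kˣ) : K) * _
    rw [hs]

end Actions

end QuasiAffine

theorem mainTheorem3 {K : Type*} [Field K] [IsAlgClosed K] [CharZero K] {n : ℕ}
    (X : Set (Fin n → K)) (hX : QuasiAffine.IsIrredQuasiAffine X)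
    (hrigid : QuasiAffine.IsRigid X) :
    ∃ 𝕋 : Subgroup (QuasiAffine.Aut X),
      QuasiAffine.IsSubtorus 𝕋 ∧
      (∀ (m : ℕ) (ρ : (Fin m → Kˣ) →* QuasiAffine.Aut X),
        QuasiAffine.IsRegularAction (QuasiAffine.torusCoord K m) ρ → ρ.range ≤ 𝕋) ∧
      (∀ S : Subgroup (QuasiAffine.Aut X),
        Maximal (fun H : Subgroup (QuasiAffine.Aut X) => QuasiAffine.IsSubtorus H) S ↔ S = 𝕋) := by
  obtain ⟨𝕋, h𝕋, hmax⟩ := QuasiAffine.exists_largest_subtorus hX hrigid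
  have hle : ∀ S : Subgroup (QuasiAffine.Aut X), QuasiAffine.IsSubtorus S → S ≤ 𝕋 := by
    rintro _ ⟨m, ρ, hρ, -, rfl⟩
    exact hmax m ρ hρ
  refine ⟨𝕋, h𝕋, hmax, fun S => ⟨fun hS => ?_, ?_⟩⟩
  · exact hS.eq_of_le h𝕋 (hle S hS.prop)
  · rintro rfl
    exact ⟨h𝕋, fun S hS _ => hle S hS⟩
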